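/- A parliamentary election consists of parties $C=\{c_1,\dots,c_m\}$ ($m\ge 1$), voters $v_1,\dots,v_n$ ($n\ge 1$) and a profile $\mathcal O=(O_1,\dots,O_n)$ of strict preference orders over $C$. The plurality score $\gamma(\mathcal O,c)$ is the number of voters who rank $c$ first. For a threshold $t\ge 0$, a party $c$ is active if $\gamma(\mathcal O,c)\ge t\cdot\sum_{c'\in C}\gamma(\mathcal O,c')$. Its seat fraction is $S_t(\mathcal O,c)=\gamma(\mathcal O,c)/\sum_{c'\text{ active}}\gamma(\mathcal O,c')$ if $c$ is active and $0$ otherwise, and $S_t(\mathcal O,D)=\sum_{c\in D}S_t(\mathcal O,c)$ for $D\subseteq C$. A bribe is any profile $\hat{\mathcal O}=(\hat O_1,\dots,\hat O_n)$. In $\$$-bribery voter $v_i$ has a price $p_i\in\mathbb N$ and the cost of $\hat{\mathcal O}$ is $\sum_{i:\hat O_i\ne O_i}p_i$; in $1$-bribery the cost is the number of $i$ with $\hat O_i\neq O_i$. Plurality$_t$-CB: given an election, a coalition $A\subseteq C$, a rational $t\ge 0$, a budget $B\in\mathbb N$, a rational target support $\varphi\in[0,1]$ (and, for $\$$-bribery,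 the prices $p_i$), decide whether there is a bribe $\hat{\mathcal O}$ such that (a) its cost is at most $B$ and (b) $S_t(\hat{\mathcal O},A)\ge\varphi\cdot S_t(\hat{\mathcal O},C)$. Plurality$_t$-CBP: given, in addition, a preferred party $c\in A$ and a rational target ratio $\rho\in[0,1]$, decide whether there is a bribe that satisfies (a), (b) and (c) $S_t(\hat{\mathcal O},c)\ge\rho\cdot S_t(\hat{\mathcal O},A)$. Statement: Plurality$_t$-CB and Plurality$_t$-CBP can each be decided in polynomial time, both for $1$-bribery and for $\$$-bribery. Here all numbers of the input, including $t$, $B$ and the prices, are written in binary, and $t=0$, the case without a threshold, is included. Polynomial time means that one program for a random access machine with logarithmic cost decides all instances, with cost bounded by a polynomial in the length of the input. -/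

import Mathlib

open scoped BigOperators NNRat

/-! ## Elections, seat allocation and bribery -/

namespace CoalitionBribery

/-- A strict preference order over `m` parties: `O k` is the party ranked in place `k`
(places are counted from `0`, so `O 0` is the favourite party). -/
abbrev PrefOrder (m : ℕ) : Type := Fin m ≃ Fin m

/-- The position of party `c` in `O`, counted from `1`. -/
def pos {m : ℕ} (O : PrefOrder m) (c : Fin m) : ℕ := (O.symm c : ℕ) + 1

/-- A parliamentary election: `m ≥ 1` parties, `n ≥ 1` voters, a preference order per voter. -/
structure Election where
  m : ℕ
  n : ℕ
  m_pos : 0 < m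
  n_pos : 0 < n
  order : Fin n → PrefOrder m

/-- A positional scoring function: the points that an order gives to a party. -/
abbrev ScoringFunction : Type := ∀ m : ℕ, PrefOrder m → Fin m → ℕ

/-- Plurality: one point for the party in first position, none for the others. -/
def plurality : ScoringFunction := fun _ O c => if pos O c = 1 then 1 else 0

section Seats

variable {m n : ℕ} (γ : ScoringFunction) (t : ℚ≥0) (O : Fin n → PrefOrder m)

/-- The total number of points of the parties in `D` under the profile `O`. -/
def points (D : Finset (Fin m)) : ℕ := ∑ i, ∑ c ∈ D, γ m (O i) c

/-- Party `c` is active if it gets at least a `t` fraction of the total number of points. -/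
def IsActive (c : Fin m) : Prop :=
  ¬ ((points γ O {c} : ℚ≥0) < t * (points γ O Finset.univ : ℚ≥0))

open Classical in
/-- The fraction of seats allotted to party `c`. -/
noncomputable def seats (c : Fin m) : ℚ≥0 :=
  if IsActive γ t O c then
    (points γ O {c} : ℚ≥0) /
      ∑ c' ∈ Finset.univ.filter (fun c' => IsActive γ t O c'), (points γ O {c'} : ℚ≥0)
  else 0

/-- The fraction of seats allotted to a set of parties. -/
noncomputable def seatsOf (D : Finset (Fin m)) : ℚ≥0 := ∑ c ∈ D, seats γ t O c

end Seats

/-- `π i P Q` is the cost of changing the order of voter `i` from `P` to `Q`. -/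
abbrev PriceFunction (m n : ℕ) : Type := Fin n → PrefOrder m → PrefOrder m → ℕ

/-- The cost of replacing the profile `O` by the profile `O'`. -/
def bribeCost {m n : ℕ} (π : PriceFunction m n) (O O' : Fin n → PrefOrder m) : ℕ :=
  ∑ i, π i (O i) (O' i)

/-- `1`-bribery: every voter whose order is changed costs `1`. -/
def unitPrice (m n : ℕ) : PriceFunction m n := fun _ P Q => if Q = P then 0 else 1

/-- `$`-bribery: voter `i`, if the order is changed in any way, costs `p i`. -/
def dollarPrice (m : ℕ) {n : ℕ} (p : Fin n → ℕ) : PriceFunction m n :=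
  fun i P Q => if Q = P then 0 else p i

/-- The data of the Coalition-Bribery problem, without the price function and without the
scoring function. `threshold = 0` is the case without a minimum support requirement. -/
structure CB where
  E : Election
  /-- the coalition -/
  A : Finset (Fin E.m)
  /-- the min size threshold `t` of the seat allocation function -/
  threshold : ℚ≥0
  /-- the budget -/
  B : ℕ
  /-- the target support -/
  φ : ℚ≥0
  φ_le_one : φ ≤ 1

/-- The data of the Coalition-Bribery-with-Preferred-party problem. -/
structure CBP extends CB where
  /-- the preferred party -/
  preferred : Fin E.m
  preferred_mem : preferred ∈ A
  /-- the target ratio -/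
  ρ : ℚ≥0
  ρ_le_one : ρ ≤ 1

/-- Coalition-Bribery with individual prices of the voters. -/
structure DollarCB extends CB where
  price : Fin E.n → ℕ

/-- Coalition-Bribery-with-Preferred-party with individual prices of the voters. -/
structure DollarCBP extends CBP where
  price : Fin E.n → ℕ

/-- The question of CB: is there a bribe within the budget after which the coalition reaches its
target support? -/
def CB.Solvable (γ : ScoringFunction) (I : CB) (π : PriceFunction I.E.m I.E.n) : Prop :=
  ∃ O' : Fin I.E.n → PrefOrder I.E.m,
    bribeCost π I.E.order O' ≤ I.B ∧
    seatsOf γ I.threshold O' I.A ≥ I.φ * seatsOf γ I.threshold O' Finset.univ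

/-- The question of CBP: in addition, the preferred party reaches the target ratio within the
coalition. -/
def CBP.Solvable (γ : ScoringFunction) (I : CBP) (π : PriceFunction I.E.m I.E.n) : Prop :=
  ∃ O' : Fin I.E.n → PrefOrder I.E.m,
    bribeCost π I.E.order O' ≤ I.B ∧
    seatsOf γ I.threshold O' I.A ≥ I.φ * seatsOf γ I.threshold O' Finset.univ ∧
    seats γ I.threshold O' I.preferred ≥ I.ρ * seatsOf γ I.threshold O' I.A

/-! ### Instances as finite sequences of natural numbers

Numbers are later measured by their binary length. A rational is given by its numerator and
denominator, the coalition by its indicator vector, the orders are listed voter by voter, each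
one from the first place to the last. -/

def CB.encode (I : CB) : List ℕ :=
  [I.E.m, I.E.n, I.B, I.threshold.num, I.threshold.den, I.φ.num, I.φ.den] ++
    List.ofFn (fun c : Fin I.E.m => if c ∈ I.A then 1 else 0) ++
    (List.ofFn fun i : Fin I.E.n => List.ofFn fun k : Fin I.E.m => (I.E.order i k : ℕ)).flatten

def CBP.encode (I : CBP) : List ℕ :=
  I.toCB.encode ++ [(I.preferred : ℕ), I.ρ.num, I.ρ.den]

def DollarCB.encode (I : DollarCB) : List ℕ := I.toCB.encode ++ List.ofFn I.price

def DollarCBP.encode (I : DollarCBP) : List ℕ := I.toCBP.encode ++ List.ofFn I.price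

end CoalitionBribery

/-! ## Polynomial time: random access machines with logarithmic cost -/

namespace RAM

/-- The contents of the registers and of the random access memory. -/
structure State where
  reg : ℕ → ℕ
  mem : ℕ → ℕ

/-- Write `v` to register `r`. -/
def State.setReg (s : State) (r v : ℕ) : State := { s with reg := Function.update s.reg r v }

/-- Write `v` to memory cell `a`. -/
def State.setMem (s : State) (a v : ℕ) : State := { s with mem := Function.update s.mem a v }

/-- Programs. The arguments `r`, `x`, `y` are names of registers; a program is a finite object, so
it mentions only finitely many of them. -/
inductive Prog : Type
  /-- do nothing -/
  | skip : Prog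
  /-- `r := k`, for a constant `k` -/
  | const (r k : ℕ) : Prog
  /-- `r := x + y` -/
  | add (r x y : ℕ) : Prog
  /-- `r := x - y`, which is `0` if `x < y` -/
  | sub (r x y : ℕ) : Prog
  /-- `r := x * y` -/
  | mul (r x y : ℕ) : Prog
  /-- `r := mem[x]` -/
  | load (r x : ℕ) : Prog
  /-- `mem[x] := y` -/
  | store (x y : ℕ) : Prog
  /-- sequential composition -/
  | seq (p q : Prog) : Prog
  /-- if `x < y` then `p` else `q` -/
  | ifLt (x y : ℕ) (p q : Prog) : Prog
  /-- while `x < y` do `p` -/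
  | whileLt (x y : ℕ) (p : Prog) : Prog

/-- `Exec p s s' T`: started in `s`, the program `p` halts in `s'`, at the cost `T`. An elementary
operation costs `1` plus the binary lengths of all numbers (data and addresses) that it reads or
writes. -/
inductive Exec : Prog → State → State → ℕ → Prop
  | skip (s : State) : Exec .skip s s 1
  | const (s : State) (r k : ℕ) : Exec (.const r k) s (s.setReg r k) (1 + k.size)
  | add (s : State) (r x y : ℕ) :
      Exec (.add r x y) s (s.setReg r (s.reg x + s.reg y))
        (1 + (s.reg x).size + (s.reg y).size + (s.reg x + s.reg y).size)
  | sub (s : State) (r x y : ℕ) :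
      Exec (.sub r x y) s (s.setReg r (s.reg x - s.reg y))
        (1 + (s.reg x).size + (s.reg y).size + (s.reg x - s.reg y).size)
  | mul (s : State) (r x y : ℕ) :
      Exec (.mul r x y) s (s.setReg r (s.reg x * s.reg y))
        (1 + (s.reg x).size + (s.reg y).size + (s.reg x * s.reg y).size)
  | load (s : State) (r x : ℕ) :
      Exec (.load r x) s (s.setReg r (s.mem (s.reg x)))
        (1 + (s.reg x).size + (s.mem (s.reg x)).size)
  | store (s : State) (x y : ℕ) :
      Exec (.store x y) s (s.setMem (s.reg x) (s.reg y))
        (1 + (s.reg x).size + (s.reg y).size)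
  | seq {p q : Prog} {s₁ s₂ s₃ : State} {T₁ T₂ : ℕ} :
      Exec p s₁ s₂ T₁ → Exec q s₂ s₃ T₂ → Exec (.seq p q) s₁ s₃ (T₁ + T₂)
  | ifTrue {x y : ℕ} {p q : Prog} {s s' : State} {T : ℕ} :
      s.reg x < s.reg y → Exec p s s' T →
      Exec (.ifLt x y p q) s s' (1 + (s.reg x).size + (s.reg y).size + T)
  | ifFalse {x y : ℕ} {p q : Prog} {s s' : State} {T : ℕ} :
      ¬ s.reg x < s.reg y → Exec q s s' T →
      Exec (.ifLt x y p q) s s' (1 + (s.reg x).size + (s.reg y).size + T)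
  | whileTrue {x y : ℕ} {p : Prog} {s₁ s₂ s₃ : State} {T₁ T₂ : ℕ} :
      s₁.reg x < s₁.reg y → Exec p s₁ s₂ T₁ → Exec (.whileLt x y p) s₂ s₃ T₂ →
      Exec (.whileLt x y p) s₁ s₃ (1 + (s₁.reg x).size + (s₁.reg y).size + T₁ + T₂)
  | whileFalse {x y : ℕ} {p : Prog} {s : State} :
      ¬ s.reg x < s.reg y →
      Exec (.whileLt x y p) s s (1 + (s.reg x).size + (s.reg y).size)

/-- The machine is deterministic: the final state and the cost are functions of the program and
the initial state. -/
theorem Exec.det {p : Prog} {s s₁ s₂ : State} {T₁ T₂ : ℕ} (h₁ : Exec p s s₁ T₁)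
    (h₂ : Exec p s s₂ T₂) : s₁ = s₂ ∧ T₁ = T₂ := by
  induction h₁ generalizing s₂ T₂ with
  | seq _ _ ih₁ ih₂ =>
    cases h₂ with
    | seq a b =>
      obtain ⟨rfl, rfl⟩ := ih₁ a
      obtain ⟨rfl, rfl⟩ := ih₂ b
      exact ⟨rfl, rfl⟩
  | ifTrue h _ ih =>
    cases h₂ with
    | ifTrue _ a => obtain ⟨rfl, rfl⟩ := ih a; exact ⟨rfl, rfl⟩
    | ifFalse h' _ => exact absurd h h'
  | ifFalse h _ ih =>
    cases h₂ with
    | ifTrue h' _ => exact absurd h' h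
    | ifFalse _ a => obtain ⟨rfl, rfl⟩ := ih a; exact ⟨rfl, rfl⟩
  | whileTrue h _ _ ih₁ ih₂ =>
    cases h₂ with
    | whileTrue _ a b =>
      obtain ⟨rfl, rfl⟩ := ih₁ a
      obtain ⟨rfl, rfl⟩ := ih₂ b
      exact ⟨rfl, rfl⟩
    | whileFalse h' => exact absurd h h'
  | whileFalse h =>
    cases h₂ with
    | whileTrue h' _ _ => exact absurd h' h
    | whileFalse _ => exact ⟨rfl, rfl⟩
  | _ => cases h₂; exact ⟨rfl, rfl⟩

/-- The initial state on input `w`: the numbers of `w` stand in the memory cells `0, 1, …`,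
register `0` holds the number of them, everything else is `0`. -/
def init (w : List ℕ) : State where
  reg := Function.update (fun _ => 0) 0 w.length
  mem := fun a => w.getD a 0

/-- The length of an input: binary length, plus one separator for each number. -/
def inputLength (w : List ℕ) : ℕ := (w.map fun x => x.size + 1).sum

/-- `L` can be decided in polynomial time, its instances being presented by `encode`: one program
halts on every instance with cost at most a fixed polynomial in the length of the input, with
register `0` holding `1` on the yes-instances and `0` on the no-instances. -/
def PolyTimeDecidable {α : Type} (encode : α → List ℕ) (L : α → Prop) : Prop :=
  ∃ (p : Prog) (f : Polynomial ℕ), ∀ I : α, ∃ (s : State) (T : ℕ),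
    Exec p (init (encode I)) s T ∧ T ≤ f.eval (inputLength (encode I)) ∧
    (L I → s.reg 0 = 1) ∧ (¬ L I → s.reg 0 = 0)

end RAM

/-! ## A loop language whose programs run in polynomial time -/

/-! Under plurality only the vector of first-place counts after the bribe matters. If party `c` is
to end with score `x`, at least all but `x` of its voters must be paid. Paying all but its `x`
dearest voters is cheapest, by an exchange argument (`sum_le_sum_dearest`). Conversely, for any
score vector with sum `n`, keeping those dearest voters and sending the others wherever votes are
missing attains the sum of these costs (`exists_bribe`). So `exists_bribe_iff` replaces profiles by
vectors `x` with sum `n` and a cost that is separable over the parties.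

Activity compares a score with `t * n`, where `n` is the fixed total, so it too depends on each
party's own score alone. After the common denominator of the seat fractions is cancelled, the
support and ratio conditions are linear inequalities between the total counted score, the part of it
in the coalition, and that of the preferred party. A knapsack-like dynamic program over the parties
therefore suffices, indexed by the total score and these three sums, all at most `n`. Prices and
budget occur only as table values, so their binary encoding does no harm (`lt_table_iff`,
`feasible_iff_table`). CB is CBP with target ratio `0`.

For the machine, programs are written in a small language whose loops all run `N` times, where `N`
is the number of input entries, and whose products have a factor at most `N`. The number of steps is
then a polynomial in `N`, and each step adds only boundedly many bits, so the logarithmic cost is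
polynomial (`compile_runs`, `polyTimeDecidable_of_run`). The table is laid out behind the input in
base `N`, and `run_fill` shows that it is filled correctly. -/

namespace RAM

open Polynomial in
/-- Evaluation of a polynomial with natural coefficients is monotone. -/
theorem eval_le_eval_of_le (f : ℕ[X]) {a b : ℕ} (h : a ≤ b) : f.eval a ≤ f.eval b := by
  rw [Polynomial.eval_eq_sum_range, Polynomial.eval_eq_sum_range]
  gcongr

/-! ### Step counts with controlled growth of the numbers -/

/-- All registers and memory cells hold numbers of at most `b` bits. -/
def Bounded (b : ℕ) (s : State) : Prop := (∀ r, s.reg r < 2 ^ b) ∧ ∀ a, s.mem a < 2 ^ b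

theorem Bounded.mono {b b' : ℕ} {s : State} (h : Bounded b s) (hb : b ≤ b') : Bounded b' s :=
  ⟨fun r => (h.1 r).trans_le (Nat.pow_le_pow_right two_pos hb),
   fun a => (h.2 a).trans_le (Nat.pow_le_pow_right two_pos hb)⟩

theorem Bounded.setReg {b : ℕ} {s : State} (h : Bounded b s) {r v : ℕ} (hv : v < 2 ^ b) :
    Bounded b (s.setReg r v) := by
  refine ⟨fun r' => ?_, h.2⟩
  by_cases hr : r' = r
  · subst hr; simpa [State.setReg] using hv
  · simpa [State.setReg, hr] using h.1 r'

theorem Bounded.setMem {b : ℕ} {s : State} (h : Bounded b s) {a v : ℕ} (hv : v < 2 ^ b) :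
    Bounded b (s.setMem a v) := by
  refine ⟨h.1, fun a' => ?_⟩
  by_cases ha : a' = a
  · subst ha; simpa [State.setMem] using hv
  · simpa [State.setMem, ha] using h.2 a'

/-- `p` leads from `s` to `s'` in at most `k` steps, where a step lengthens the numbers by at most
`g` bits. -/
def Runs (g : ℕ) (p : Prog) (s s' : State) (k : ℕ) : Prop :=
  ∀ b, g ≤ b → Bounded b s → Bounded (b + g * k) s' ∧
    ∃ T, Exec p s s' T ∧ T ≤ k * (1 + 3 * (b + g * k))

theorem Runs.mono {g k k' : ℕ} {p : Prog} {s s' : State} (h : Runs g p s s' k) (hk : k ≤ k') :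
    Runs g p s s' k' := by
  intro b hb hs
  obtain ⟨h₁, T, hT, hle⟩ := h b hb hs
  exact ⟨h₁.mono (by gcongr), T, hT, hle.trans (by gcongr)⟩

/-- Running times of consecutive runs add up, also together with the cost of a test. -/
theorem add_cost_le {g b k₁ k₂ T₁ T₂ : ℕ} (h₁ : T₁ ≤ k₁ * (1 + 3 * (b + g * k₁)))
    (h₂ : T₂ ≤ k₂ * (1 + 3 * (b + g * k₁ + g * k₂))) :
    T₁ + T₂ ≤ (k₁ + k₂) * (1 + 3 * (b + g * (k₁ + k₂))) := by
  have h₃ : k₁ * (1 + 3 * (b + g * k₁)) ≤ k₁ * (1 + 3 * (b + g * (k₁ + k₂))) := by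
    gcongr; omega
  have h₄ : k₂ * (1 + 3 * (b + g * k₁ + g * k₂)) = k₂ * (1 + 3 * (b + g * (k₁ + k₂))) := by ring
  rw [add_mul]
  omega

theorem Runs.seq {g k₁ k₂ : ℕ} {p q : Prog} {s₁ s₂ s₃ : State} (h₁ : Runs g p s₁ s₂ k₁)
    (h₂ : Runs g q s₂ s₃ k₂) : Runs g (.seq p q) s₁ s₃ (k₁ + k₂) := by
  intro b hb hs
  obtain ⟨hs₂, T₁, e₁, l₁⟩ := h₁ b hb hs
  obtain ⟨hs₃, T₂, e₂, l₂⟩ := h₂ _ (hb.trans (Nat.le_add_right _ _)) hs₂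
  refine ⟨?_, _, .seq e₁ e₂, add_cost_le l₁ l₂⟩
  rwa [mul_add, ← add_assoc]

theorem Bounded.size_reg {b : ℕ} {s : State} (h : Bounded b s) (r : ℕ) : (s.reg r).size ≤ b :=
  Nat.size_le.2 (h.1 r)

theorem Bounded.size_mem {b : ℕ} {s : State} (h : Bounded b s) (a : ℕ) : (s.mem a).size ≤ b :=
  Nat.size_le.2 (h.2 a)

/-- The constant may have more than `g` bits; charging `k + 1` steps for it leaves room for its
length, since `k < 2 ^ k`. -/
theorem Runs.const {g : ℕ} (hg : 1 ≤ g) (s : State) (r k : ℕ) :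
    Runs g (.const r k) s (s.setReg r k) (k + 1) := by
  intro b hb hs
  have hk : k < 2 ^ k := Nat.lt_two_pow_self
  have hgk : k + 1 ≤ g * (k + 1) := Nat.le_mul_of_pos_left _ hg
  refine ⟨(hs.mono (Nat.le_add_right _ _)).setReg
    (hk.trans_le (Nat.pow_le_pow_right two_pos (by omega))), _, .const s r k, ?_⟩
  have : k.size ≤ k := Nat.size_le.2 hk
  calc 1 + k.size ≤ 1 * (1 + 3 * (b + g * (k + 1))) := by omega
    _ ≤ _ := by gcongr; omega

theorem Runs.add {g : ℕ} (hg : 1 ≤ g) (s : State) (r x y : ℕ) :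
    Runs g (.add r x y) s (s.setReg r (s.reg x + s.reg y)) 1 := by
  intro b hb hs
  have hx := hs.1 x
  have hy := hs.1 y
  have hv : s.reg x + s.reg y < 2 ^ (b + g * 1) :=
    calc s.reg x + s.reg y < 2 ^ (b + 1) := by rw [pow_succ]; omega
      _ ≤ _ := Nat.pow_le_pow_right two_pos (by omega)
  refine ⟨(hs.mono (Nat.le_add_right _ _)).setReg hv, _, .add s r x y, ?_⟩
  have := hs.size_reg x
  have := hs.size_reg y
  have := Nat.size_le.2 hv
  omega

theorem Runs.sub {g : ℕ} (s : State) (r x y : ℕ) :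
    Runs g (.sub r x y) s (s.setReg r (s.reg x - s.reg y)) 1 := by
  intro b hb hs
  have hv : s.reg x - s.reg y < 2 ^ b := (Nat.sub_le _ _).trans_lt (hs.1 x)
  refine ⟨(hs.setReg hv).mono (Nat.le_add_right _ _), _, .sub s r x y, ?_⟩
  have := hs.size_reg x
  have := hs.size_reg y
  have := Nat.size_le.2 hv
  omega

/-- Bounding one factor makes the length grow additively. Without such a bound repeated squaring
would double it at every step. -/
theorem Runs.mul {g : ℕ} (s : State) (r x y : ℕ) (hx : s.reg x < 2 ^ g) :
    Runs g (.mul r x y) s (s.setReg r (s.reg x * s.reg y)) 1 := by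
  intro b hb hs
  have hv : s.reg x * s.reg y < 2 ^ (b + g * 1) := by
    rw [mul_one, pow_add, mul_comm (2 ^ b)]
    exact Nat.mul_lt_mul'' hx (hs.1 y)
  refine ⟨(hs.mono (Nat.le_add_right _ _)).setReg hv, _, .mul s r x y, ?_⟩
  have := hs.size_reg x
  have := hs.size_reg y
  have := Nat.size_le.2 hv
  omega

theorem Runs.load {g : ℕ} (s : State) (r x : ℕ) :
    Runs g (.load r x) s (s.setReg r (s.mem (s.reg x))) 1 := by
  intro b hb hs
  refine ⟨(hs.setReg (hs.2 _)).mono (Nat.le_add_right _ _), _, .load s r x, ?_⟩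
  have := hs.size_reg x
  have := hs.size_mem (s.reg x)
  omega

theorem Runs.store {g : ℕ} (s : State) (x y : ℕ) :
    Runs g (.store x y) s (s.setMem (s.reg x) (s.reg y)) 1 := by
  intro b hb hs
  refine ⟨(hs.setMem (hs.1 _)).mono (Nat.le_add_right _ _), _, .store s x y, ?_⟩
  have := hs.size_reg x
  have := hs.size_reg y
  omega

theorem test_cost_le {g b : ℕ} {s : State} (hs : Bounded b s) (x y : ℕ) :
    1 + (s.reg x).size + (s.reg y).size ≤ 1 * (1 + 3 * (b + g * 1)) := by
  have := hs.size_reg x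
  have := hs.size_reg y
  omega

theorem Runs.ifTrue {g k x y : ℕ} {p q : Prog} {s s' : State} (h : s.reg x < s.reg y)
    (hp : Runs g p s s' k) : Runs g (.ifLt x y p q) s s' (1 + k) := by
  intro b hb hs
  obtain ⟨hs', T, e, l⟩ := hp (b + g * 1) (by omega) (hs.mono (Nat.le_add_right _ _))
  refine ⟨?_, _, .ifTrue h e, add_cost_le (test_cost_le hs x y) l⟩
  rwa [mul_add, ← add_assoc]

theorem Runs.ifFalse {g k x y : ℕ} {p q : Prog} {s s' : State} (h : ¬ s.reg x < s.reg y)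
    (hq : Runs g q s s' k) : Runs g (.ifLt x y p q) s s' (1 + k) := by
  intro b hb hs
  obtain ⟨hs', T, e, l⟩ := hq (b + g * 1) (by omega) (hs.mono (Nat.le_add_right _ _))
  refine ⟨?_, _, .ifFalse h e, add_cost_le (test_cost_le hs x y) l⟩
  rwa [mul_add, ← add_assoc]

theorem Runs.whileFalse {g x y : ℕ} {p : Prog} {s : State} (h : ¬ s.reg x < s.reg y) :
    Runs g (.whileLt x y p) s s 1 := fun _ _ hs =>
  ⟨hs.mono (Nat.le_add_right _ _), _, .whileFalse h, test_cost_le hs x y⟩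

theorem Runs.whileTrue {g k₁ k₂ x y : ℕ} {p : Prog} {s₁ s₂ s₃ : State} (h : s₁.reg x < s₁.reg y)
    (h₁ : Runs g p s₁ s₂ k₁) (h₂ : Runs g (.whileLt x y p) s₂ s₃ k₂) :
    Runs g (.whileLt x y p) s₁ s₃ (1 + k₁ + k₂) := by
  intro b hb hs
  obtain ⟨hs₂, T₁, e₁, l₁⟩ := h₁ (b + g * 1) (by omega) (hs.mono (Nat.le_add_right _ _))
  obtain ⟨hs₃, T₂, e₂, l₂⟩ := h₂ (b + g * (1 + k₁)) (by omega) (by rwa [mul_add, ← add_assoc])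
  refine ⟨?_, _, .whileTrue h e₁ e₂, add_cost_le (add_cost_le (test_cost_le hs x y) l₁) l₂⟩
  rwa [mul_add, ← add_assoc]

/-- A loop whose counter `x` runs from `0` to the value `N` of register `y`. -/
theorem Runs.while_count {g N k x y : ℕ} {p : Prog} (P : ℕ → State → Prop)
    (hP : ∀ j s, P j s → s.reg x = j ∧ s.reg y = N)
    (hstep : ∀ j s, j < N → P j s → ∃ s', Runs g p s s' k ∧ P (j + 1) s')
    {s : State} (h₀ : P 0 s) : ∃ s', Runs g (.whileLt x y p) s s' (N * (k + 1) + 1) ∧ P N s' := by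
  have key : ∀ r j s, j + r = N → P j s →
      ∃ s', Runs g (.whileLt x y p) s s' (r * (k + 1) + 1) ∧ P N s' := by
    intro r
    induction r with
    | zero =>
      intro j s hj hs
      have hx := hP j s hs
      refine ⟨s, (Runs.whileFalse (by omega)).mono (by omega), ?_⟩
      have : j = N := by omega
      exact this ▸ hs
    | succ r ih =>
      intro j s hj hs
      have hx := hP j s hs
      obtain ⟨s₁, h₁, hs₁⟩ := hstep j s (by omega) hs
      obtain ⟨s₂, h₂, hs₂⟩ := ih (j + 1) s₁ (by omega) hs₁
      exact ⟨s₂, (Runs.whileTrue (by omega) h₁ h₂).mono (by rw [add_mul r 1]; omega), hs₂⟩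
  exact key N 0 s (by omega) h₀

/-! ### The loop language, its semantics and its compiler -/

/-- Expressions over a memory and a list of variables, which are numbered from the innermost. The
bound `N` of all loops is a parameter of the evaluation. -/
inductive Exp : Type
  | num (k : ℕ) : Exp
  | var (i : ℕ) : Exp
  /-- the bound of the loops -/
  | len : Exp
  | ld (a : Exp) : Exp
  | add (a b : Exp) : Exp
  | sub (a b : Exp) : Exp
  /-- the product `a * b`, provided that `a` is at most the loop bound -/
  | mul (a b : Exp) : Exp
  /-- if `a < b` then `p` else `q` -/
  | ite (a b p q : Exp) : Exp
  /-- bounded recursion; `body` sees the accumulator as variable `0` and the counter as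
  variable `1` -/
  | fold (start body : Exp) : Exp

/-- Statements: memory writes, sequences, and loops that bind a counter. -/
inductive Stmt : Type
  | store (a e : Exp) : Stmt
  | seq (S S' : Stmt) : Stmt
  | loop (S : Stmt) : Stmt

/-- The value of an expression. -/
def Exp.eval (N : ℕ) (mem : ℕ → ℕ) : Exp → List ℕ → ℕ
  | .num k, _ => k
  | .var i, env => env.getD i N
  | .len, _ => N
  | .ld a, env => mem (a.eval N mem env)
  | .add a b, env => a.eval N mem env + b.eval N mem env
  | .sub a b, env => a.eval N mem env - b.eval N mem env
  | .mul a b, env => if N < a.eval N mem env then 0 else a.eval N mem env * b.eval N mem env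
  | .ite a b p q, env =>
      if a.eval N mem env < b.eval N mem env then p.eval N mem env else q.eval N mem env
  | .fold start body, env =>
      Nat.rec (start.eval N mem env) (fun i acc => body.eval N mem (acc :: i :: env)) N

/-- The memory after a statement. -/
def Stmt.run (N : ℕ) : Stmt → List ℕ → (ℕ → ℕ) → (ℕ → ℕ)
  | .store a e, env, mem => Function.update mem (a.eval N mem env) (e.eval N mem env)
  | .seq S S', env, mem => S'.run N env (S.run N env mem)
  | .loop S, env, mem => Nat.rec mem (fun i mem' => S.run N (i :: env) mem') N

/-- Compilation of an expression: `ctx` lists the registers of the variables, the result appears in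
register `d`, and no register below `d` is changed. -/
def Exp.compile : Exp → List ℕ → ℕ → Prog
  | .num k, _, d => .const d k
  | .var i, ctx, d => .seq (.const d 0) (.add d d (ctx.getD i 0))
  | .len, _, d => .seq (.const d 0) (.add d d 0)
  | .ld a, ctx, d => .seq (a.compile ctx d) (.load d d)
  | .add a b, ctx, d => .seq (a.compile ctx d) (.seq (b.compile ctx (d + 1)) (.add d d (d + 1)))
  | .sub a b, ctx, d => .seq (a.compile ctx d) (.seq (b.compile ctx (d + 1)) (.sub d d (d + 1)))
  | .mul a b, ctx, d => .seq (a.compile ctx d) (.seq (b.compile ctx (d + 1))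
      (.ifLt 0 d (.const d 0) (.mul d d (d + 1))))
  | .ite a b p q, ctx, d => .seq (a.compile ctx d) (.seq (b.compile ctx (d + 1))
      (.ifLt d (d + 1) (p.compile ctx d) (q.compile ctx d)))
  | .fold start body, ctx, d => .seq (start.compile ctx d) (.seq (.const (d + 1) 0)
      (.whileLt (d + 1) 0 (.seq (body.compile (d :: (d + 1) :: ctx) (d + 2))
        (.seq (.const d 0) (.seq (.add d d (d + 2))
          (.seq (.const (d + 2) 1) (.add (d + 1) (d + 1) (d + 2))))))))

/-- Compilation of a statement, with the registers from `d` on as work space. -/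
def Stmt.compile : Stmt → List ℕ → ℕ → Prog
  | .store a e, ctx, d => .seq (a.compile ctx d) (.seq (e.compile ctx (d + 1)) (.store d (d + 1)))
  | .seq S S', ctx, d => .seq (S.compile ctx d) (S'.compile ctx d)
  | .loop S, ctx, d => .seq (.const d 0) (.whileLt d 0 (.seq (S.compile (d :: ctx) (d + 1))
      (.seq (.const (d + 1) 1) (.add d d (d + 1)))))

open Polynomial in
/-- A bound for the number of steps of a compiled expression. -/
noncomputable def Exp.steps : Exp → ℕ[X]
  | .num k => C (k + 1)
  | .var _ => 2
  | .len => 2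
  | .ld a => a.steps + 1
  | .add a b => a.steps + (b.steps + 1)
  | .sub a b => a.steps + (b.steps + 1)
  | .mul a b => a.steps + (b.steps + 2)
  | .ite a b p q => a.steps + (b.steps + (1 + (p.steps + q.steps)))
  | .fold start body => start.steps + (1 + (X * (body.steps + 5 + 1) + 1))

open Polynomial in
/-- A bound for the number of steps of a compiled statement. -/
noncomputable def Stmt.steps : Stmt → ℕ[X]
  | .store a e => a.steps + (e.steps + 1)
  | .seq S S' => S.steps + S'.steps
  | .loop S => 1 + (X * (S.steps + 3 + 1) + 1)

@[simp] theorem State.setReg_mem (s : State) (r v : ℕ) : (s.setReg r v).mem = s.mem := rfl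

@[simp] theorem State.setReg_reg (s : State) (r v r' : ℕ) :
    (s.setReg r v).reg r' = if r' = r then v else s.reg r' := by
  simp [State.setReg, Function.update_apply]

theorem map_reg_congr {s s' : State} {ctx : List ℕ} {d : ℕ} (hctx : ∀ r ∈ ctx, r < d)
    (h : ∀ r < d, s'.reg r = s.reg r) : ctx.map s'.reg = ctx.map s.reg :=
  List.map_congr_left fun r hr => h r (hctx r hr)

/-- The outcome of a compiled expression. -/
structure Exp.Outcome (N : ℕ) (e : Exp) (ctx : List ℕ) (d : ℕ) (s s' : State) : Prop where
  mem_eq : s'.mem = s.mem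
  reg_eq : ∀ r < d, s'.reg r = s.reg r
  value : s'.reg d = e.eval N s.mem (ctx.map s.reg)

/-- Common part of all constructs that first evaluate two expressions: the second evaluation works
from `d + 1` upwards, so it leaves the first value in register `d` intact. -/
theorem Exp.compile_binary {g N k : ℕ} {a b : Exp} {ctx : List ℕ} {d : ℕ} {p : Prog} {s : State}
    (hd : 0 < d) (hctx : ∀ r ∈ ctx, r < d) (hs : s.reg 0 = N)
    (ha : ∀ ctx d s, 0 < d → (∀ r ∈ ctx, r < d) → s.reg 0 = N →
      ∃ s', Runs g (a.compile ctx d) s s' (a.steps.eval N) ∧ a.Outcome N ctx d s s')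
    (hb : ∀ ctx d s, 0 < d → (∀ r ∈ ctx, r < d) → s.reg 0 = N →
      ∃ s', Runs g (b.compile ctx d) s s' (b.steps.eval N) ∧ b.Outcome N ctx d s s')
    (Q : State → Prop)
    (hp : ∀ s₂ : State, s₂.mem = s.mem → (∀ r < d, s₂.reg r = s.reg r) →
      s₂.reg d = a.eval N s.mem (ctx.map s.reg) → s₂.reg (d + 1) = b.eval N s.mem (ctx.map s.reg) →
      ∃ s', Runs g p s₂ s' k ∧ Q s') :
    ∃ s', Runs g (.seq (a.compile ctx d) (.seq (b.compile ctx (d + 1)) p)) s s'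
      (a.steps.eval N + (b.steps.eval N + k)) ∧ Q s' := by
  obtain ⟨s₁, r₁, o₁⟩ := ha ctx d s hd hctx hs
  obtain ⟨s₂, r₂, o₂⟩ := hb ctx (d + 1) s₁ (by omega) (fun r hr => (hctx r hr).trans (by omega))
    (by rw [o₁.reg_eq 0 hd, hs])
  obtain ⟨s₃, r₃, q⟩ := hp s₂ (o₂.mem_eq.trans o₁.mem_eq)
    (fun r hr => (o₂.reg_eq r (by omega)).trans (o₁.reg_eq r hr))
    ((o₂.reg_eq d (by omega)).trans o₁.value)
    (by rw [o₂.value, o₁.mem_eq, map_reg_congr hctx o₁.reg_eq])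
  exact ⟨s₃, r₁.seq (r₂.seq r₃), q⟩

/-- Register `0` keeps the loop bound `N` throughout because work space starts at `d > 0`. The guard
in `mul` compares with it, so `N < 2 ^ g` supplies the bounded factor for `Runs.mul`. -/
theorem Exp.compile_runs {g N : ℕ} (hg : 1 ≤ g) (hN : N < 2 ^ g) (e : Exp) :
    ∀ ctx d s, 0 < d → (∀ r ∈ ctx, r < d) → s.reg 0 = N →
      ∃ s', Runs g (e.compile ctx d) s s' (e.steps.eval N) ∧ e.Outcome N ctx d s s' := by
  induction e with
  | num k =>
    intro ctx d s hd hctx hs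
    refine ⟨_, (Runs.const hg s d k).mono (by simp [steps]), rfl, fun r hr => ?_, ?_⟩
    · simp [hr.ne]
    · simp [eval]
  | var i =>
    intro ctx d s hd hctx hs
    refine ⟨_, ((Runs.const hg s d 0).seq (Runs.add hg _ d d _)).mono (by simp [steps]), rfl,
      fun r hr => ?_, ?_⟩
    · simp [hr.ne]
    -- A variable outside the context is read from register `0`, which holds `N`; this matches the
    -- default value `N` in `Exp.eval`.
    · have : ctx.getD i 0 ≠ d := by
        rw [List.getD_eq_getElem?_getD]
        rcases h : ctx[i]? with _ | r
        · simpa using hd.ne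
        · simpa using (hctx r (List.mem_of_getElem? h)).ne
      rw [State.setReg_reg, if_pos rfl, State.setReg_reg, if_pos rfl, State.setReg_reg,
        if_neg this, eval, ← hs, List.getD_map, zero_add]
  | len =>
    intro ctx d s hd hctx hs
    refine ⟨_, ((Runs.const hg s d 0).seq (Runs.add hg _ d d 0)).mono (by simp [steps]), rfl,
      fun r hr => ?_, ?_⟩
    · simp [hr.ne]
    · simp [eval, hd.ne, hs]
  | ld a iha =>
    intro ctx d s hd hctx hs
    obtain ⟨s₁, r₁, o₁⟩ := iha ctx d s hd hctx hs
    refine ⟨_, (r₁.seq (Runs.load s₁ d d)).mono (by simp [steps]), ?_, fun r hr => ?_, ?_⟩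
    · simp [o₁.mem_eq]
    · simp [hr.ne, o₁.reg_eq r hr]
    · simp [eval, o₁.value, o₁.mem_eq]
  | add a b iha ihb =>
    intro ctx d s hd hctx hs
    simp only [steps, Polynomial.eval_add, Polynomial.eval_one]
    refine compile_binary hd hctx hs iha ihb _ fun s₂ hm hr ha hb =>
      ⟨_, Runs.add hg s₂ d d (d + 1), hm, fun r h => ?_, ?_⟩
    · simp [h.ne, hr r h]
    · simp [eval, ha, hb]
  | sub a b iha ihb =>
    intro ctx d s hd hctx hs
    simp only [steps, Polynomial.eval_add, Polynomial.eval_one]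
    refine compile_binary hd hctx hs iha ihb _ fun s₂ hm hr ha hb =>
      ⟨_, Runs.sub s₂ d d (d + 1), hm, fun r h => ?_, ?_⟩
    · simp [h.ne, hr r h]
    · simp [eval, ha, hb]
  | mul a b iha ihb =>
    intro ctx d s hd hctx hs
    simp only [steps, Polynomial.eval_add, Polynomial.eval_ofNat]
    refine compile_binary hd hctx hs iha ihb _ fun s₂ hm hr ha hb => ?_
    have h0 : s₂.reg 0 = N := by rw [hr 0 hd, hs]
    by_cases h : N < a.eval N s.mem (ctx.map s.reg)
    · refine ⟨_, Runs.ifTrue (by rwa [h0, ha]) (Runs.const hg s₂ d 0), hm, fun r h => ?_, ?_⟩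
      · simp [h.ne, hr r h]
      · simp [eval, h]
    · refine ⟨_, Runs.ifFalse (by rwa [h0, ha]) (Runs.mul s₂ d d (d + 1) ?_), hm,
        fun r h => ?_, ?_⟩
      · rw [ha]; omega
      · simp [h.ne, hr r h]
      · simp [eval, h, ha, hb]
  | ite a b p q iha ihb ihp ihq =>
    intro ctx d s hd hctx hs
    simp only [steps, Polynomial.eval_add, Polynomial.eval_one]
    refine compile_binary hd hctx hs iha ihb _ fun s₂ hm hr ha hb => ?_
    have h0 : s₂.reg 0 = N := by rw [hr 0 hd, hs]
    by_cases h : a.eval N s.mem (ctx.map s.reg) < b.eval N s.mem (ctx.map s.reg)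
    · obtain ⟨s₃, r₃, o₃⟩ := ihp ctx d s₂ hd hctx h0
      refine ⟨s₃, (Runs.ifTrue (by rwa [ha, hb]) r₃).mono (by omega), o₃.mem_eq.trans hm,
        fun r h => (o₃.reg_eq r h).trans (hr r h), ?_⟩
      rw [o₃.value, hm, map_reg_congr hctx hr, eval, if_pos h]
    · obtain ⟨s₃, r₃, o₃⟩ := ihq ctx d s₂ hd hctx h0
      refine ⟨s₃, (Runs.ifFalse (by rwa [ha, hb]) r₃).mono (by omega), o₃.mem_eq.trans hm,
        fun r h => (o₃.reg_eq r h).trans (hr r h), ?_⟩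
      rw [o₃.value, hm, map_reg_congr hctx hr, eval, if_neg h]
  | fold start body ihs ihb =>
    intro ctx d s hd hctx hs
    obtain ⟨s₁, r₁, o₁⟩ := ihs ctx d s hd hctx hs
    have r₂ := Runs.const hg s₁ (d + 1) 0
    -- The `5` pays for copying the result into the accumulator, `1 + 1`, and for incrementing the
    -- counter, `2 + 1`, since loading the constant `1` counts as two steps.
    obtain ⟨s₃, r₃, h₃⟩ := Runs.while_count (g := g) (N := N) (k := body.steps.eval N + 5)
      (x := d + 1) (y := 0)
      (p := .seq (body.compile (d :: (d + 1) :: ctx) (d + 2))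
        (.seq (.const d 0) (.seq (.add d d (d + 2))
          (.seq (.const (d + 2) 1) (.add (d + 1) (d + 1) (d + 2))))))
      (fun j s' => s'.reg (d + 1) = j ∧ s'.mem = s.mem ∧ (∀ r < d, s'.reg r = s.reg r) ∧
        s'.reg d = Nat.rec (start.eval N s.mem (ctx.map s.reg))
          (fun i acc => body.eval N s.mem (acc :: i :: ctx.map s.reg)) j)
      (fun j s' h => ⟨h.1, by rw [h.2.2.1 0 hd, hs]⟩)
      (fun j s' hj h => by
        obtain ⟨hc, hm, hr, hv⟩ := h
        obtain ⟨s₄, r₄, o₄⟩ := ihb (d :: (d + 1) :: ctx) (d + 2) s' (by omega)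
          (by
            intro r hr'
            rcases List.mem_cons.1 hr' with rfl | hr'
            · omega
            rcases List.mem_cons.1 hr' with rfl | hr'
            · omega
            · exact (hctx r hr').trans (by omega))
          (by rw [hr 0 hd, hs])
        have hval := o₄.value
        rw [List.map_cons, List.map_cons, map_reg_congr hctx hr, hc, hv, hm] at hval
        refine ⟨_, (r₄.seq ((Runs.const hg _ d 0).seq ((Runs.add hg _ d d (d + 2)).seq
          ((Runs.const hg _ (d + 2) 1).seq (Runs.add hg _ (d + 1) (d + 1) (d + 2)))))), ?_, ?_,
          fun r h => ?_, ?_⟩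
        · simp [o₄.reg_eq (d + 1) (by omega), hc]
        · simp [o₄.mem_eq, hm]
        · have h1 : r ≠ d := by omega
          have h2 : r ≠ d + 1 := by omega
          have h3 : r ≠ d + 2 := by omega
          simp [h1, h2, h3, o₄.reg_eq r (by omega), hr r h]
        · simp [hval])
      (s := s₁.setReg (d + 1) 0)
      ⟨by simp, o₁.mem_eq, fun r h => by
        have h1 : r ≠ d + 1 := by omega
        simp [h1, o₁.reg_eq r h], by simp [o₁.value]⟩
    refine ⟨s₃, (r₁.seq (r₂.seq r₃)).mono (by simp [steps]), h₃.2.1, h₃.2.2.1, h₃.2.2.2⟩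

theorem Stmt.compile_runs {g N : ℕ} (hg : 1 ≤ g) (hN : N < 2 ^ g) (S : Stmt) :
    ∀ ctx d s, 0 < d → (∀ r ∈ ctx, r < d) → s.reg 0 = N →
      ∃ s', Runs g (S.compile ctx d) s s' (S.steps.eval N) ∧
        s'.mem = S.run N (ctx.map s.reg) s.mem ∧ ∀ r < d, s'.reg r = s.reg r := by
  induction S with
  | store a e =>
    intro ctx d s hd hctx hs
    simp only [steps, Polynomial.eval_add, Polynomial.eval_one]
    refine Exp.compile_binary hd hctx hs (a.compile_runs hg hN) (e.compile_runs hg hN) _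
      fun s₂ hm hr ha hb => ⟨_, Runs.store s₂ d (d + 1), ?_, fun r h => ?_⟩
    · simp [State.setMem, run, hm, ha, hb]
    · simp [State.setMem, hr r h]
  | seq S S' ih ih' =>
    intro ctx d s hd hctx hs
    obtain ⟨s₁, r₁, m₁, h₁⟩ := ih ctx d s hd hctx hs
    obtain ⟨s₂, r₂, m₂, h₂⟩ := ih' ctx d s₁ hd hctx (by rw [h₁ 0 hd, hs])
    refine ⟨s₂, (r₁.seq r₂).mono (by simp [steps]), ?_, fun r h => (h₂ r h).trans (h₁ r h)⟩
    rw [m₂, m₁, map_reg_congr hctx h₁, run]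
  | loop S ih =>
    intro ctx d s hd hctx hs
    have r₂ := Runs.const hg s d 0
    obtain ⟨s₃, r₃, h₃⟩ := Runs.while_count (g := g) (N := N) (k := S.steps.eval N + 3)
      (x := d) (y := 0)
      (p := .seq (S.compile (d :: ctx) (d + 1)) (.seq (.const (d + 1) 1) (.add d d (d + 1))))
      (fun j s' => s'.reg d = j ∧ (∀ r < d, s'.reg r = s.reg r) ∧
        s'.mem = Nat.rec s.mem (fun i mem' => S.run N (i :: ctx.map s.reg) mem') j)
      (fun j s' h => ⟨h.1, by rw [h.2.1 0 hd, hs]⟩)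
      (fun j s' hj h => by
        obtain ⟨hc, hr, hm⟩ := h
        obtain ⟨s₄, r₄, m₄, h₄⟩ := ih (d :: ctx) (d + 1) s' (by omega)
          (by
            intro r hr'
            rcases List.mem_cons.1 hr' with rfl | hr'
            · omega
            · exact (hctx r hr').trans (by omega))
          (by rw [hr 0 hd, hs])
        rw [List.map_cons, map_reg_congr hctx hr, hc, hm] at m₄
        refine ⟨_, (r₄.seq ((Runs.const hg _ (d + 1) 1).seq (Runs.add hg _ d d (d + 1)))), ?_,
          fun r h => ?_, ?_⟩
        · simp [h₄ d (by omega), hc]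
        · have h1 : r ≠ d := by omega
          have h2 : r ≠ d + 1 := by omega
          simp [h1, h2, h₄ r (by omega), hr r h]
        · simp [m₄])
      (s := s.setReg d 0)
      ⟨by simp, fun r h => by simp [h.ne], by simp⟩
    exact ⟨s₃, (r₂.seq r₃).mono (by simp [steps]), h₃.2.2, h₃.2.1⟩

/-! ### From step counts to polynomial time -/

theorem length_le_inputLength (w : List ℕ) : w.length ≤ inputLength w := by
  induction w with
  | nil => simp
  | cons a w ih => simp only [inputLength, List.map_cons, List.sum_cons, List.length_cons] at *; omega

theorem size_le_inputLength {w : List ℕ} {x : ℕ} (hx : x ∈ w) : x.size ≤ inputLength w := by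
  have : x.size + 1 ≤ inputLength w :=
    List.single_le_sum (fun _ _ => Nat.zero_le _) _ (List.mem_map_of_mem hx)
  omega

theorem bounded_init (w : List ℕ) : Bounded (inputLength w + 1) (init w) := by
  refine ⟨fun r => ?_, fun a => ?_⟩
  · by_cases hr : r = 0
    · subst hr
      simpa [init] using (length_le_inputLength w).trans_lt
        ((Nat.lt_succ_self _).trans Nat.lt_two_pow_self)
    · simp [init, hr]
  · simp only [init, List.getD_eq_getElem?_getD]
    rcases h : w[a]? with _ | x
    · simp
    · refine Nat.size_le.1 ?_
      have := size_le_inputLength (List.mem_of_getElem? h)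
      simpa using this.trans (Nat.le_succ _)

/-- A program of the loop language, followed by the output of an expression, decides in polynomial
time. -/
theorem polyTimeDecidable_of_run {α : Type} {encode : α → List ℕ} {L : α → Prop} (S : Stmt)
    (e : Exp)
    (h : ∀ I, let N := (encode I).length
      let v := e.eval N (S.run N [] (init (encode I)).mem) []
      (L I → v = 1) ∧ (¬ L I → v = 0)) : PolyTimeDecidable encode L := by
  classical
  let K : Polynomial ℕ := S.steps + (e.steps + (1 + 1))
  -- The cost polynomial is the bound in `Runs` for `K` steps, with both the initial length `b` and
  -- the growth `g` equal to the input length plus `1`.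
  refine ⟨.seq (S.compile [] 1) (.seq (e.compile [] 1) (.seq (.const 0 0) (.add 0 0 1))),
    K * (1 + 3 * (Polynomial.X + 1 + (Polynomial.X + 1) * K)), fun I => ?_⟩
  set w := encode I with hw
  set n := inputLength w with hn
  have hN : w.length < 2 ^ (n + 1) :=
    (length_le_inputLength w).trans_lt ((Nat.lt_succ_self _).trans Nat.lt_two_pow_self)
  have hg : 1 ≤ n + 1 := by omega
  have h0 : (init w).reg 0 = w.length := by simp [init]
  obtain ⟨s₁, r₁, m₁, h₁⟩ := S.compile_runs hg hN [] 1 (init w) one_pos (by simp) h0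
  obtain ⟨s₂, r₂, o₂⟩ := e.compile_runs hg hN [] 1 s₁ one_pos (by simp)
    (by rw [h₁ 0 one_pos, h0])
  have r := r₁.seq (r₂.seq ((Runs.const hg s₂ 0 0).seq (Runs.add hg _ 0 0 1)))
  obtain ⟨-, T, hT, hle⟩ := r (n + 1) le_rfl (bounded_init w)
  refine ⟨_, T, hT, hle.trans ?_, ?_⟩
  · have hK : S.steps.eval w.length + (e.steps.eval w.length + (0 + 1 + 1)) ≤ K.eval n := by
      have := eval_le_eval_of_le K (length_le_inputLength w)
      simpa [K] using this
    simp only [Polynomial.eval_mul, Polynomial.eval_add, Polynomial.eval_one, Polynomial.eval_X,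
      Polynomial.eval_ofNat]
    gcongr
  · have := h I
    simp only [← hw] at this
    simpa [o₂.value, m₁] using this

end RAM

/-! ## Bribery in terms of the plurality scores -/

namespace CoalitionBribery

/-! ### Ranking by price and the exchange argument -/

section Dearest

variable {ι : Type*} [LinearOrder ι] (V : Finset ι) (p : ι → ℕ)

/-- The number of elements of `V` that are at least as dear as `i`; ties are broken by the order of
the indices. -/
def dearRank (i : ι) : ℕ := (V.filter fun j => p i < p j ∨ p i = p j ∧ i ≤ j).card

variable {V p}

/-- Everything counted for `j` is counted for `i` by transitivity, and `i` itself is counted only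
for `i`. -/
theorem dearRank_lt {i j : ι} (hi : i ∈ V) (h : p i < p j ∨ p i = p j ∧ i < j) :
    dearRank V p j < dearRank V p i := by
  refine Finset.card_lt_card ⟨fun k hk => ?_, fun hs => ?_⟩
  · rw [Finset.mem_filter] at hk ⊢
    refine ⟨hk.1, ?_⟩
    rcases h with h | ⟨h, hij⟩ <;> rcases hk.2 with h' | ⟨h', hjk⟩
    · exact Or.inl (h.trans h')
    · exact Or.inl (h' ▸ h)
    · exact Or.inl (h ▸ h')
    · exact Or.inr ⟨h.trans h', (hij.trans_le hjk).le⟩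
  · have := hs (Finset.mem_filter.2 ⟨hi, Or.inr ⟨rfl, le_rfl⟩⟩)
    rw [Finset.mem_filter] at this
    rcases this.2 with h' | ⟨h', hji⟩ <;> rcases h with h | ⟨h, hij⟩
    · omega
    · omega
    · omega
    · exact absurd hij (not_lt.2 hji)

theorem dearRank_injOn : Set.InjOn (dearRank V p) V := by
  intro i hi j hj h
  by_contra hne
  rcases lt_trichotomy (p i) (p j) with hp | hp | hp
  · exact (dearRank_lt hi (Or.inl hp)).ne' h
  · rcases lt_or_gt_of_ne hne with hij | hij
    · exact (dearRank_lt hi (Or.inr ⟨hp, hij⟩)).ne' h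
    · exact (dearRank_lt hj (Or.inr ⟨hp.symm, hij⟩)).ne h
  · exact (dearRank_lt hj (Or.inl hp)).ne h

/-- Ranks are distinct and lie between `1` and the size of `V`, so all these values occur. Hence a
rank threshold `x` selects exactly `min x V.card` elements. -/
theorem image_dearRank : V.image (dearRank V p) = Finset.Icc 1 V.card := by
  refine Finset.eq_of_subset_of_card_le (fun k hk => ?_) ?_
  · obtain ⟨i, hi, rfl⟩ := Finset.mem_image.1 hk
    rw [Finset.mem_Icc]
    exact ⟨Finset.card_pos.2 ⟨i, Finset.mem_filter.2 ⟨hi, Or.inr ⟨rfl, le_rfl⟩⟩⟩,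
      Finset.card_filter_le _ _⟩
  · rw [Finset.card_image_of_injOn dearRank_injOn]
    simp

theorem card_dearRank_le (x : ℕ) :
    (V.filter fun i => dearRank V p i ≤ x).card = min x V.card := by
  rw [← Finset.card_image_of_injOn (f := dearRank V p)
    (dearRank_injOn.mono (Finset.coe_subset.2 (Finset.filter_subset _ _)))]
  have : (V.filter fun i => dearRank V p i ≤ x).image (dearRank V p) =
      (V.image (dearRank V p)).filter (· ≤ x) := by
    rw [Finset.filter_image]
  rw [this, image_dearRank]
  have : (Finset.Icc 1 V.card).filter (· ≤ x) = Finset.Icc 1 (min x V.card) := by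
    ext k; simp; omega
  rw [this]; simp

/-- The `x` dearest elements of `V` are at least as dear as any `x` elements. -/
theorem sum_le_sum_dearest {K : Finset ι} (hK : K ⊆ V) {x : ℕ} (hx : K.card ≤ x) :
    ∑ i ∈ K, p i ≤ ∑ i ∈ V.filter (fun i => dearRank V p i ≤ x), p i := by
  classical
  set D := V.filter fun i => dearRank V p i ≤ x with hD
  have hcard : (K \ D).card ≤ (D \ K).card := by
    have h₁ := Finset.card_sdiff_add_card_inter K D
    have h₂ := Finset.card_sdiff_add_card_inter D K
    rw [Finset.inter_comm] at h₂
    have h₃ : D.card = min x V.card := card_dearRank_le x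
    have h₄ := Finset.card_le_card hK
    omega
  have hdear : ∀ i ∈ K \ D, ∀ j ∈ D \ K, p i ≤ p j := by
    intro i hi j hj
    rw [Finset.mem_sdiff, hD, Finset.mem_filter] at hi hj
    by_contra! hlt
    have h₁ := dearRank_lt hj.1.1 (Or.inl hlt)
    have h₂ : x < dearRank V p i := by
      by_contra! h
      exact hi.2 ⟨hK hi.1, h⟩
    omega
  -- The cheapest element of `D \ K` separates the prices: those in `K \ D` are at most its price,
  -- those in `D \ K` at least.
  have hdiff : ∑ i ∈ K \ D, p i ≤ ∑ j ∈ D \ K, p j := by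
    rcases (D \ K).eq_empty_or_nonempty with h | h
    · rw [h, Finset.card_empty, Nat.le_zero, Finset.card_eq_zero] at hcard
      simp [hcard]
    · obtain ⟨j, hj, hmin⟩ := Finset.exists_min_image (D \ K) p h
      calc ∑ i ∈ K \ D, p i ≤ (K \ D).card • p j :=
            Finset.sum_le_card_nsmul _ _ _ fun i hi => hdear i hi j hj
        _ ≤ (D \ K).card • p j := by gcongr
        _ ≤ _ := Finset.card_nsmul_le_sum _ _ _ hmin
  rw [← Finset.sum_inter_add_sum_sdiff K D, ← Finset.sum_inter_add_sum_sdiff D K,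
    Finset.inter_comm D K]
  exact Nat.add_le_add_left hdiff _

end Dearest

/-- A function on a finite type with prescribed sizes of its fibres. -/
theorem exists_card_fiber_eq {α β : Type} [Fintype α] [Fintype β] [DecidableEq β] (d : β → ℕ)
    (h : ∑ b, d b = Fintype.card α) :
    ∃ f : α → β, ∀ b, (Finset.univ.filter fun a => f a = b).card = d b := by
  classical
  have hcard : Fintype.card α = Fintype.card (Σ b, Fin (d b)) := by simp [h]
  let e := Fintype.equivOfCardEq hcard
  refine ⟨fun a => (e a).1, fun b => ?_⟩
  have : (Finset.univ.filter fun a => (e a).1 = b) =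
      Finset.univ.image fun i : Fin (d b) => e.symm ⟨b, i⟩ := by
    ext a
    simp only [Finset.mem_filter, Finset.mem_univ, true_and, Finset.mem_image]
    constructor
    · intro ha
      subst ha
      exact ⟨(e a).2, by simp⟩
    · rintro ⟨i, rfl⟩
      simp
  rw [this, Finset.card_image_of_injective _ fun i j hij => by simpa using hij]
  simp

/-! ### Bribes and score vectors -/

section Bribes

variable {m n : ℕ} (hm : 0 < m)

/-- The favourite party. -/
def favourite (O : PrefOrder m) : Fin m := O ⟨0, hm⟩

/-- The plurality scores of the parties. -/
def score (O : Fin n → PrefOrder m) (c : Fin m) : ℕ :=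
  (Finset.univ.filter fun i => favourite hm (O i) = c).card

theorem plurality_eq (O : PrefOrder m) (c : Fin m) :
    plurality m O c = if favourite hm O = c then 1 else 0 := by
  have : pos O c = 1 ↔ favourite hm O = c := by
    rw [pos, favourite, ← Equiv.eq_symm_apply, Fin.ext_iff]
    simp only
    omega
  simp only [plurality, this]

theorem points_plurality (O : Fin n → PrefOrder m) (D : Finset (Fin m)) :
    points plurality O D = ∑ c ∈ D, score hm O c := by
  simp only [points, plurality_eq hm, score, Finset.card_filter]
  exact Finset.sum_comm

theorem sum_score (O : Fin n → PrefOrder m) : ∑ c, score hm O c = n := by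
  have := Finset.card_eq_sum_card_fiberwise (s := (Finset.univ : Finset (Fin n)))
    (t := (Finset.univ : Finset (Fin m))) (f := fun i => favourite hm (O i)) (by simp)
  simpa [score] using this.symm

/-- The least cost of reducing the score of `c` to at most `x`. -/
def reductionCost (O : Fin n → PrefOrder m) (p : Fin n → ℕ) (c : Fin m) (x : ℕ) : ℕ :=
  ∑ i ∈ (Finset.univ.filter fun i => favourite hm (O i) = c).filter
    (fun i => x < dearRank (Finset.univ.filter fun i => favourite hm (O i) = c) p i), p i

theorem bribeCost_eq (O O' : Fin n → PrefOrder m) (p : Fin n → ℕ) :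
    bribeCost (dollarPrice m p) O O' =
      ∑ c, ∑ i ∈ Finset.univ.filter (fun i => favourite hm (O i) = c),
        if O' i = O i then 0 else p i := by
  rw [bribeCost, Finset.sum_fiberwise]
  rfl

/-- The unchanged voters of `c` still vote for `c`, so there are at most `score hm O' c` of them,
and together they are worth no more than that many dearest voters. Taking complements among the
voters of `c` bounds the price paid from below. -/
theorem sum_reductionCost_le (O O' : Fin n → PrefOrder m) (p : Fin n → ℕ) :
    ∑ c, reductionCost hm O p c (score hm O' c) ≤ bribeCost (dollarPrice m p) O O' := by
  rw [bribeCost_eq hm]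
  refine Finset.sum_le_sum fun c _ => ?_
  set V := Finset.univ.filter fun i => favourite hm (O i) = c with hV
  have h₁ : ∑ i ∈ V.filter (fun i => O' i = O i), p i ≤
      ∑ i ∈ V.filter (fun i => dearRank V p i ≤ score hm O' c), p i := by
    refine sum_le_sum_dearest (Finset.filter_subset _ _) (Finset.card_le_card fun i hi => ?_)
    simp only [hV, Finset.mem_filter, Finset.mem_univ, true_and] at hi ⊢
    rw [hi.2, hi.1]
  have h₂ := Finset.sum_filter_add_sum_filter_not V (fun i => O' i = O i) p
  have h₃ := Finset.sum_filter_add_sum_filter_not V (fun i => dearRank V p i ≤ score hm O' c) p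
  have h₄ : ∑ i ∈ V, (if O' i = O i then 0 else p i) = ∑ i ∈ V.filter (fun i => ¬ O' i = O i), p i := by
    rw [Finset.sum_filter (fun i => ¬ O' i = O i)]
    simp only [ite_not]
  simp only [reductionCost, ← hV, h₄]
  simp only [not_le] at h₃
  omega

/-- Each party keeps its dearest voters, up to `x c` of them. All other voters are free to be
distributed so as to fill the remaining demand exactly. -/
theorem exists_bribe (O : Fin n → PrefOrder m) (p : Fin n → ℕ) (x : Fin m → ℕ)
    (hx : ∑ c, x c = n) :
    ∃ O' : Fin n → PrefOrder m, score hm O' = x ∧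
      bribeCost (dollarPrice m p) O O' ≤ ∑ c, reductionCost hm O p c (x c) := by
  classical
  let V : Fin m → Finset (Fin n) := fun c => Finset.univ.filter fun i => favourite hm (O i) = c
  let kept : Fin n → Prop := fun i => dearRank (V (favourite hm (O i))) p i ≤ x (favourite hm (O i))
  have hkept : ∀ c, (Finset.univ.filter fun i => kept i ∧ favourite hm (O i) = c).card ≤ x c := by
    intro c
    refine le_trans (Finset.card_le_card fun i hi => ?_)
      ((card_dearRank_le (V := V c) (p := p) (x c)).trans_le (min_le_left _ _))
    simp only [Finset.mem_filter, Finset.mem_univ, true_and, V, kept] at hi ⊢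
    obtain ⟨h, rfl⟩ := hi
    exact ⟨rfl, h⟩
  have hsum : ∑ c, (Finset.univ.filter fun i => kept i ∧ favourite hm (O i) = c).card =
      (Finset.univ.filter kept).card := by
    rw [Finset.card_eq_sum_card_fiberwise (t := (Finset.univ : Finset (Fin m)))
      (f := fun i => favourite hm (O i)) (by simp)]
    simp only [Finset.filter_filter]
  have hcompl := Finset.card_filter_add_card_filter_not (s := (Finset.univ : Finset (Fin n))) kept
  -- The deficits of the parties add up to `n` minus the number of kept voters, which is the number
  -- of voters to distribute.
  obtain ⟨f, hf⟩ := exists_card_fiber_eq (α := {i // ¬ kept i})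
    (fun c => x c - (Finset.univ.filter fun i => kept i ∧ favourite hm (O i) = c).card) (by
      rw [Finset.sum_tsub_distrib _ fun c _ => hkept c, hx, hsum, Fintype.card_subtype]
      simp only [Finset.card_univ, Fintype.card_fin] at hcompl
      omega)
  let top' : Fin n → Fin m := fun i => if h : kept i then favourite hm (O i) else f ⟨i, h⟩
  -- Exchanging the old favourite with the new one leaves the order of a kept voter literally
  -- unchanged, hence free of charge.
  let O' : Fin n → PrefOrder m := fun i => (O i).trans (Equiv.swap (favourite hm (O i)) (top' i))
  have hfav : ∀ i, favourite hm (O' i) = top' i := fun i => by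
    simp only [favourite, O', Equiv.trans_apply]
    exact Equiv.swap_apply_left _ _
  have hsame : ∀ i, kept i → O' i = O i := fun i hi => by
    simp only [O', top', dif_pos hi, Equiv.swap_self]
    rfl
  refine ⟨O', funext fun c => ?_, ?_⟩
  · have h₁ := Finset.card_filter_add_card_filter_not
      (s := Finset.univ.filter fun i => favourite hm (O' i) = c) kept
    have h₂ : (Finset.univ.filter fun i => favourite hm (O' i) = c).filter kept =
        Finset.univ.filter fun i => kept i ∧ favourite hm (O i) = c := by
      ext i
      simp only [Finset.mem_filter, Finset.mem_univ, true_and, hfav]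
      constructor
      · rintro ⟨h, hi⟩
        exact ⟨hi, by simpa [top', hi] using h⟩
      · rintro ⟨hi, h⟩
        exact ⟨by simpa [top', hi] using h, hi⟩
    have h₃ : ((Finset.univ.filter fun i => favourite hm (O' i) = c).filter fun i => ¬ kept i) =
        (Finset.univ.filter fun a => f a = c).map (Function.Embedding.subtype _) := by
      ext i
      simp only [Finset.mem_filter, Finset.mem_univ, true_and, hfav, Finset.mem_map,
        Function.Embedding.subtype_apply]
      constructor
      · rintro ⟨h, hi⟩
        exact ⟨⟨i, hi⟩, by simpa [top', hi] using h, rfl⟩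
      · rintro ⟨⟨j, hj⟩, h, rfl⟩
        exact ⟨by simpa [top', hj] using h, hj⟩
    rw [h₂, h₃, Finset.card_map, hf] at h₁
    have := hkept c
    rw [score]
    omega
  · rw [bribeCost_eq hm]
    refine Finset.sum_le_sum fun c _ => ?_
    rw [reductionCost, Finset.sum_filter _ p]
    refine Finset.sum_le_sum fun i hi => ?_
    obtain rfl : favourite hm (O i) = c := by simpa using hi
    by_cases hk : kept i
    · simp [hsame i hk]
    · rw [if_pos (not_le.1 hk)]
      split_ifs <;> simp

/-- Up to costs, a bribe is a vector of plurality scores. -/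
theorem exists_bribe_iff (O : Fin n → PrefOrder m) (p : Fin n → ℕ) (B : ℕ)
    (P : (Fin m → ℕ) → Prop) :
    (∃ O' : Fin n → PrefOrder m, bribeCost (dollarPrice m p) O O' ≤ B ∧ P (score hm O')) ↔
      ∃ x : Fin m → ℕ, ∑ c, x c = n ∧ ∑ c, reductionCost hm O p c (x c) ≤ B ∧ P x := by
  constructor
  · rintro ⟨O', hB, hP⟩
    exact ⟨_, sum_score hm O', (sum_reductionCost_le hm O O' p).trans hB, hP⟩
  · rintro ⟨x, hx, hB, hP⟩
    obtain ⟨O', rfl, h⟩ := exists_bribe hm O p x hx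
    exact ⟨O', h.trans hB, hP⟩

/-! ### Seat conditions as linear inequalities -/

/-- The points of a party with score `x` that count in the allotment of the seats: all of them if
the party is active, none otherwise. -/
def countedScore (n : ℕ) (t : ℚ≥0) (x : ℕ) : ℕ := if t.num * n ≤ t.den * x then x else 0

/-- The case `w = 0` occurs when no counted points exist, for instance if no party is active. Every
quotient is then `0`, and both sides hold. -/
theorem mul_div_le_div_iff (q : ℚ≥0) {a b w : ℕ} (hw : w = 0 → a = 0 ∧ b = 0) :
    (a : ℚ≥0) / w ≥ q * (b / w) ↔ q.num * b ≤ q.den * a := by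
  rcases Nat.eq_zero_or_pos w with rfl | hpos
  · obtain ⟨rfl, rfl⟩ := hw rfl
    simp
  · have hw' : (0 : ℚ≥0) < w := by exact_mod_cast hpos
    have hd : (0 : ℚ≥0) < q.den := by exact_mod_cast q.den_pos
    rw [ge_iff_le, ← mul_div_assoc, div_le_div_iff_of_pos_right hw']
    conv_lhs => rw [← NNRat.num_div_den q]
    rw [div_mul_eq_mul_div, div_le_iff₀ hd, mul_comm (a : ℚ≥0)]
    exact_mod_cast Iff.rfl

theorem isActive_plurality_iff (t : ℚ≥0) (O : Fin n → PrefOrder m) (c : Fin m) :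
    IsActive plurality t O c ↔ t.num * n ≤ t.den * score hm O c := by
  have hd : (0 : ℚ≥0) < t.den := by exact_mod_cast t.den_pos
  rw [IsActive, points_plurality hm, points_plurality hm, sum_score, Finset.sum_singleton, not_lt]
  conv_lhs => rw [← NNRat.num_div_den t]
  rw [div_mul_eq_mul_div, div_le_iff₀ hd, mul_comm (score hm O c : ℚ≥0)]
  exact_mod_cast Iff.rfl

theorem seats_plurality (t : ℚ≥0) (O : Fin n → PrefOrder m) (c : Fin m) :
    seats plurality t O c = (countedScore n t (score hm O c) : ℚ≥0) /
      ((∑ c', countedScore n t (score hm O c') : ℕ) : ℚ≥0) := by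
  classical
  have hsum : ((∑ c', countedScore n t (score hm O c') : ℕ) : ℚ≥0) =
      ∑ c' ∈ Finset.univ.filter (fun c' => IsActive plurality t O c'),
        (points plurality O {c'} : ℚ≥0) := by
    rw [Finset.sum_filter]
    push_cast
    refine Finset.sum_congr rfl fun c' _ => ?_
    simp only [isActive_plurality_iff hm, countedScore, points_plurality hm, Finset.sum_singleton]
    split_ifs <;> simp
  rw [seats, hsum]
  simp only [isActive_plurality_iff hm, countedScore, points_plurality hm, Finset.sum_singleton]
  split_ifs <;> simp

theorem seatsOf_plurality (t : ℚ≥0) (O : Fin n → PrefOrder m) (D : Finset (Fin m)) :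
    seatsOf plurality t O D = ((∑ c ∈ D, countedScore n t (score hm O c) : ℕ) : ℚ≥0) /
      ((∑ c, countedScore n t (score hm O c) : ℕ) : ℚ≥0) := by
  simp only [seatsOf, seats_plurality hm, ← Finset.sum_div, Nat.cast_sum]

theorem sum_eq_zero_of_univ {y : Fin m → ℕ} (h : ∑ c, y c = 0) (D : Finset (Fin m)) :
    ∑ c ∈ D, y c = 0 :=
  Nat.le_zero.1 (h ▸ Finset.sum_le_univ_sum_of_nonneg fun _ => Nat.zero_le _)

theorem support_iff (t φ : ℚ≥0) (O : Fin n → PrefOrder m) (A : Finset (Fin m)) :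
    seatsOf plurality t O A ≥ φ * seatsOf plurality t O Finset.univ ↔
      φ.num * ∑ c, countedScore n t (score hm O c) ≤
        φ.den * ∑ c ∈ A, countedScore n t (score hm O c) := by
  rw [seatsOf_plurality hm, seatsOf_plurality hm]
  exact mul_div_le_div_iff φ fun h => ⟨sum_eq_zero_of_univ h A, h⟩

theorem ratio_iff (t ρ : ℚ≥0) (O : Fin n → PrefOrder m) (A : Finset (Fin m)) (c : Fin m) :
    seats plurality t O c ≥ ρ * seatsOf plurality t O A ↔
      ρ.num * ∑ c ∈ A, countedScore n t (score hm O c) ≤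
        ρ.den * countedScore n t (score hm O c) := by
  rw [seats_plurality hm, seatsOf_plurality hm]
  exact mul_div_le_div_iff ρ fun h =>
    ⟨by simpa using sum_eq_zero_of_univ h {c}, sum_eq_zero_of_univ h A⟩

theorem cb_solvable_iff (I : CB) (p : Fin I.E.n → ℕ) :
    I.Solvable plurality (dollarPrice I.E.m p) ↔ ∃ x : Fin I.E.m → ℕ, ∑ c, x c = I.E.n ∧
      ∑ c, reductionCost I.E.m_pos I.E.order p c (x c) ≤ I.B ∧
      I.φ.num * ∑ c, countedScore I.E.n I.threshold (x c) ≤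
        I.φ.den * ∑ c ∈ I.A, countedScore I.E.n I.threshold (x c) := by
  simp only [CB.Solvable, support_iff I.E.m_pos]
  exact exists_bribe_iff I.E.m_pos I.E.order p I.B fun x =>
    I.φ.num * ∑ c, countedScore I.E.n I.threshold (x c) ≤
      I.φ.den * ∑ c ∈ I.A, countedScore I.E.n I.threshold (x c)

theorem cbp_solvable_iff (I : CBP) (p : Fin I.E.n → ℕ) :
    I.Solvable plurality (dollarPrice I.E.m p) ↔ ∃ x : Fin I.E.m → ℕ, ∑ c, x c = I.E.n ∧
      ∑ c, reductionCost I.E.m_pos I.E.order p c (x c) ≤ I.B ∧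
      I.φ.num * ∑ c, countedScore I.E.n I.threshold (x c) ≤
        I.φ.den * ∑ c ∈ I.A, countedScore I.E.n I.threshold (x c) ∧
      I.ρ.num * ∑ c ∈ I.A, countedScore I.E.n I.threshold (x c) ≤
        I.ρ.den * countedScore I.E.n I.threshold (x I.preferred) := by
  simp only [CBP.Solvable, support_iff I.E.m_pos, ratio_iff I.E.m_pos]
  exact exists_bribe_iff I.E.m_pos I.E.order p I.B fun x =>
    I.φ.num * ∑ c, countedScore I.E.n I.threshold (x c) ≤
      I.φ.den * ∑ c ∈ I.A, countedScore I.E.n I.threshold (x c) ∧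
    I.ρ.num * ∑ c ∈ I.A, countedScore I.E.n I.threshold (x c) ≤
      I.ρ.den * countedScore I.E.n I.threshold (x I.preferred)

end Bribes

end CoalitionBribery

/-! ## The dynamic program -/

namespace CoalitionBribery

/-- The numbers on which the answer depends: parties and voters are numbered from `0`, `inA` is the
indicator function of the coalition, `top i` is the favourite party of voter `i`. -/
structure ScoreData where
  m : ℕ
  n : ℕ
  B : ℕ
  tnum : ℕ
  tden : ℕ
  φnum : ℕ
  φden : ℕ
  ρnum : ℕ
  ρden : ℕ
  preferred : ℕ
  inA : ℕ → ℕ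
  top : ℕ → ℕ
  price : ℕ → ℕ
  inA_le_one : ∀ c, inA c ≤ 1

namespace ScoreData

variable (D : ScoreData)

/-- The number of voters with the favourite party of `i` that are at least as dear as `i`. -/
def rank (i : ℕ) : ℕ :=
  ∑ j ∈ Finset.range D.n, if D.top j = D.top i ∧
    (D.price i < D.price j ∨ D.price i = D.price j ∧ i ≤ j) then 1 else 0

/-- The least cost of reducing the score of `c` to at most `x`. -/
def cost (c x : ℕ) : ℕ :=
  ∑ i ∈ Finset.range D.n, if D.top i = c ∧ x < D.rank i then D.price i else 0

/-- The points of a party with score `x` that count in the allotment of the seats. -/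
def count (x : ℕ) : ℕ := if D.tnum * D.n ≤ D.tden * x then x else 0

/-- The contribution of party `c` with score `x` to the coalition. -/
def countA (c x : ℕ) : ℕ := D.count x * D.inA c

/-- The contribution of party `c` with score `x` to the preferred party. -/
def countP (c x : ℕ) : ℕ := if c = D.preferred then D.count x else 0

theorem count_le (x : ℕ) : D.count x ≤ x := by
  unfold count; split_ifs <;> omega

theorem countA_le (c x : ℕ) : D.countA c x ≤ x := by
  have := Nat.mul_le_mul (D.count_le x) (D.inA_le_one c)
  unfold countA; omega

theorem countP_le (c x : ℕ) : D.countP c x ≤ x := by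
  have := D.count_le x
  unfold countP; split_ifs <;> omega

/-- The question in terms of the scores after the bribe. -/
def Feasible : Prop :=
  ∃ x : ℕ → ℕ, ∑ c ∈ Finset.range D.m, x c = D.n ∧
    ∑ c ∈ Finset.range D.m, D.cost c (x c) ≤ D.B ∧
    D.φnum * ∑ c ∈ Finset.range D.m, D.count (x c) ≤
      D.φden * ∑ c ∈ Finset.range D.m, D.countA c (x c) ∧
    D.ρnum * ∑ c ∈ Finset.range D.m, D.countA c (x c) ≤
      D.ρden * ∑ c ∈ Finset.range D.m, D.countP c (x c)

/-- `table N c a b e f` is `B + 1` minus the least cost at which the first `c` parties can get the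
total score `a`, the total counted score `b`, of which `e` for the coalition and `f` for the
preferred party; it is `0` if there is no way within the budget. -/
def table (N : ℕ) : ℕ → ℕ → ℕ → ℕ → ℕ → ℕ
  | 0, a, b, e, f => if a = 0 ∧ b = 0 ∧ e = 0 ∧ f = 0 then D.B + 1 else 0
  | c + 1, a, b, e, f => if c < D.m then (Finset.range N).sup fun x =>
      if x ≤ a ∧ D.count x ≤ b ∧ D.countA c x ≤ e ∧ D.countP c x ≤ f then
        table N c (a - x) (b - D.count x) (e - D.countA c x) (f - D.countP c x) - D.cost c x
      else 0
    else 0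

/-- Since `v < T - k` means `v + k < T`, the cost of the last party moves into the bound `v`, which
must therefore stay general in the induction. Storing `B + 1` minus the cost turns both an
impossible and an overspent entry into `0`, and minimisation of costs into a maximum. -/
theorem lt_table_iff (N : ℕ) {c : ℕ} (hc : c ≤ D.m) (v a b e f : ℕ) :
    v < D.table N c a b e f ↔ ∃ x : ℕ → ℕ, (∀ i < c, x i < N) ∧
      ∑ i ∈ Finset.range c, x i = a ∧ ∑ i ∈ Finset.range c, D.count (x i) = b ∧
      ∑ i ∈ Finset.range c, D.countA i (x i) = e ∧ ∑ i ∈ Finset.range c, D.countP i (x i) = f ∧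
      v + ∑ i ∈ Finset.range c, D.cost i (x i) < D.B + 1 := by
  induction c generalizing v a b e f with
  | zero =>
    simp only [table, Finset.range_zero, Finset.sum_empty, not_lt_zero, false_imp_iff,
      implies_true, true_and, add_zero, exists_const]
    split_ifs with h
    · obtain ⟨rfl, rfl, rfl, rfl⟩ := h
      simp
    · simp only [not_lt_zero, false_iff]
      rintro ⟨h₁, h₂, h₃, h₄, -⟩
      exact h ⟨h₁.symm, h₂.symm, h₃.symm, h₄.symm⟩
  | succ c ih =>
    rw [table, if_pos (by omega : c < D.m), Finset.lt_sup_iff]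
    simp only [Finset.sum_range_succ]
    constructor
    · rintro ⟨y, hy, hv⟩
      split_ifs at hv with h
      · obtain ⟨x, hx, ha, hb, he, hf, hB⟩ := (ih (by omega) (v + D.cost c y) _ _ _ _).1
          (Nat.lt_sub_iff_add_lt.1 hv)
        have hcongr : ∀ g : ℕ → ℕ → ℕ, ∑ i ∈ Finset.range c, g i (Function.update x c y i) =
            ∑ i ∈ Finset.range c, g i (x i) := fun g => Finset.sum_congr rfl fun i hi => by
          rw [Function.update_of_ne (Finset.mem_range.1 hi).ne]
        -- The vector for the first `c` parties is extended by the score `y` of party `c`.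
        refine ⟨Function.update x c y, fun i hi => ?_, ?_⟩
        · rcases Nat.lt_succ_iff_lt_or_eq.1 hi with hi | rfl
          · rw [Function.update_of_ne hi.ne]
            exact hx i hi
          · simpa using hy
        · rw [hcongr fun _ t => t, hcongr fun _ t => D.count t, hcongr D.countA, hcongr D.countP,
            hcongr D.cost, Function.update_self]
          omega
      · exact absurd hv (by omega)
    · rintro ⟨x, hx, ha, hb, he, hf, hB⟩
      refine ⟨x c, Finset.mem_range.2 (hx c (by omega)), ?_⟩
      -- The last summand is at most the whole sum in each of the four coordinates, so the guards
      -- hold and no subtraction of indices is truncated.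
      rw [if_pos (by omega)]
      have := (ih (by omega) (v + D.cost c (x c)) (a - x c) (b - D.count (x c))
        (e - D.countA c (x c)) (f - D.countP c (x c))).2
        ⟨x, fun i hi => hx i (by omega), by omega, by omega, by omega, by omega, by omega⟩
      omega

/-- Every score and each of the three counted sums is at most `n`, so searching below `N` loses
nothing. -/
theorem feasible_iff_table {N : ℕ} (hN : D.n < N) : D.Feasible ↔
    ∃ b < N, ∃ e < N, ∃ f < N, 0 < D.table N D.m D.n b e f ∧
      D.φnum * b ≤ D.φden * e ∧ D.ρnum * e ≤ D.ρden * f := by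
  simp only [lt_table_iff D N le_rfl]
  constructor
  · rintro ⟨x, hx, hB, h₁, h₂⟩
    have hsum : ∀ g : ℕ → ℕ → ℕ, (∀ c y, g c y ≤ y) → ∑ c ∈ Finset.range D.m, g c (x c) < N :=
      fun g hg => ((Finset.sum_le_sum fun c _ => hg c (x c)).trans hx.le).trans_lt hN
    refine ⟨_, hsum (fun _ => D.count) fun _ => D.count_le, _, hsum _ D.countA_le,
      _, hsum _ D.countP_le, ⟨x, fun i hi => ?_, hx, rfl, rfl, rfl, by omega⟩, h₁, h₂⟩
    have := Finset.single_le_sum (f := x) (fun _ _ => Nat.zero_le _) (Finset.mem_range.2 hi)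
    omega
  · rintro ⟨b, -, e, -, f, -, ⟨x, -, hx, rfl, rfl, rfl, hB⟩, h₁, h₂⟩
    exact ⟨x, hx, by omega, h₁, h₂⟩

end ScoreData

end CoalitionBribery

/-! ## The dynamic program on the machine -/

namespace RAM

/-! ### Derived constructs of the loop language -/

namespace Exp

/-- The sum of `body` over the values `i < N` of variable `1`. -/
def sum (body : Exp) : Exp := .fold (.num 0) (.add (.var 0) body)

/-- The maximum of `body` over the values `i < N` of variable `1`. -/
def max (body : Exp) : Exp := .fold (.num 0) (.add (.var 0) (.sub body (.var 0)))

/-- If `a ≤ b` then `p` else `q`. -/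
def ifLe (a b p q : Exp) : Exp := .ite b a q p

/-- If `a = b` then `p` else `q`. -/
def ifEq (a b p q : Exp) : Exp := .ite a b q (.ite b a q p)

variable {N : ℕ} {mem : ℕ → ℕ} {env : List ℕ}

theorem eval_sum {body : Exp} {F : ℕ → ℕ}
    (h : ∀ i < N, ∀ acc, body.eval N mem (acc :: i :: env) = F i) :
    (sum body).eval N mem env = ∑ i ∈ Finset.range N, F i := by
  have key : ∀ k ≤ N, (Nat.rec 0 (fun i acc =>
      (Exp.add (.var 0) body).eval N mem (acc :: i :: env)) k : ℕ) =
        ∑ i ∈ Finset.range k, F i := by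
    intro k hk
    induction k with
    | zero => simp
    | succ k ih =>
      simp only [eval, List.getD_cons_zero, h k hk] at ih ⊢
      rw [ih (by omega), Finset.sum_range_succ]
  exact key N le_rfl

/-- With truncated subtraction, `acc + (F i - acc)` is the larger of `acc` and `F i`. -/
theorem eval_max {body : Exp} {F : ℕ → ℕ}
    (h : ∀ i < N, ∀ acc, body.eval N mem (acc :: i :: env) = F i) :
    (max body).eval N mem env = (Finset.range N).sup F := by
  have key : ∀ k ≤ N, (Nat.rec 0 (fun i acc =>
      (Exp.add (.var 0) (.sub body (.var 0))).eval N mem (acc :: i :: env)) k : ℕ) =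
        (Finset.range k).sup F := by
    intro k hk
    induction k with
    | zero => simp
    | succ k ih =>
      simp only [eval, List.getD_cons_zero, h k hk] at ih ⊢
      rw [ih (by omega), Finset.range_add_one, Finset.sup_insert]
      simp only [max_def]
      split_ifs <;> omega
  exact key N le_rfl

theorem eval_num (k : ℕ) : (num k).eval N mem env = k := rfl

theorem eval_ld (a : Exp) : (ld a).eval N mem env = mem (a.eval N mem env) := rfl

theorem eval_ite (a b p q : Exp) : (ite a b p q).eval N mem env =
    if a.eval N mem env < b.eval N mem env then p.eval N mem env else q.eval N mem env := rfl

theorem eval_ifLe (a b p q : Exp) : (ifLe a b p q).eval N mem env =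
    if a.eval N mem env ≤ b.eval N mem env then p.eval N mem env else q.eval N mem env := by
  simp only [ifLe, eval]
  split_ifs <;> first | rfl | omega

theorem eval_ifEq (a b p q : Exp) : (ifEq a b p q).eval N mem env =
    if a.eval N mem env = b.eval N mem env then p.eval N mem env else q.eval N mem env := by
  simp only [ifEq, eval]
  split_ifs <;> first | rfl | omega

theorem eval_mul {a : Exp} (b : Exp) (h : a.eval N mem env ≤ N) :
    (mul a b).eval N mem env = a.eval N mem env * b.eval N mem env := by
  rw [eval, if_neg (not_lt.2 h)]

end Exp

open Exp

/-- If a loop body adds a set `Q i` of correct cells in every round, then the loop adds the union. -/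
theorem Stmt.run_loop_of_step {κ : Type} {N : ℕ} {S : Stmt} {env : List ℕ}
    (Inv : Set κ → (ℕ → ℕ) → Prop) (A : Set κ) (Q : ℕ → Set κ)
    (hstep : ∀ i < N, ∀ mem A', A ⊆ A' → (∀ j < i, Q j ⊆ A') → Inv A' mem →
      Inv (A' ∪ Q i) (S.run N (i :: env) mem))
    {mem : ℕ → ℕ} (h : Inv A mem) :
    Inv (A ∪ ⋃ i ∈ Set.Iio N, Q i) ((Stmt.loop S).run N env mem) := by
  have key : ∀ k ≤ N, Inv (A ∪ ⋃ i ∈ Set.Iio k, Q i)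
      (Nat.rec mem (fun i mem' => S.run N (i :: env) mem') k) := by
    intro k hk
    induction k with
    | zero => simpa using h
    | succ k ih =>
      have := hstep k hk _ _ Set.subset_union_left
        (fun j hj => (Set.subset_biUnion_of_mem (u := Q) (Set.mem_Iio.2 hj)).trans
          Set.subset_union_right) (ih (by omega))
      convert this using 1
      ext q
      simp only [Set.mem_union, Set.mem_iUnion, Set.mem_Iio, exists_prop, Nat.lt_succ_iff_lt_or_eq]
      constructor
      · rintro (h | ⟨i, hi | rfl, h⟩)
        · exact Or.inl (Or.inl h)
        · exact Or.inl (Or.inr ⟨i, hi, h⟩)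
        · exact Or.inr h
      · rintro ((h | ⟨i, hi, h⟩) | h)
        · exact Or.inl h
        · exact Or.inr ⟨i, Or.inl hi, h⟩
        · exact Or.inr ⟨k, Or.inr rfl, h⟩
  exact key N le_rfl

end RAM

namespace CoalitionBribery

open RAM RAM.Exp

/-! ### The table program and its memory layout -/

/-- Expressions for the parts of the input whose place depends on the kind of problem. -/
structure InputForm where
  ρnum : Exp
  ρden : Exp
  preferred : Exp
  /-- the price of a voter -/
  price : Exp → Exp

/-- The number of parties. -/
def mExp : Exp := .ld (.num 0)

/-- The number of voters. -/
def nExp : Exp := .ld (.num 1)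

/-- The favourite party of voter `i`. -/
def topExp (i : Exp) : Exp := .ld (.add (.add (.num 7) mExp) (.mul i mExp))

/-- The table cell of `(c, a, b, e, f)`. -/
def cellExp (c a b e f : Exp) : Exp :=
  .add .len (.add (.mul .len (.add (.mul .len (.add (.mul .len (.add (.mul .len c) a)) b)) e)) f)

/-- See `ScoreData.count`. -/
def countExp (x : Exp) : Exp :=
  ifLe (.mul nExp (.ld (.num 3))) (.mul x (.ld (.num 4))) x (.num 0)

/-- See `ScoreData.countA`. -/
def countAExp (c x : Exp) : Exp := .mul (countExp x) (.ld (.add (.num 7) c))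

namespace InputForm

variable (P : InputForm)

/-- See `ScoreData.countP`. -/
def countPExp (c x : Exp) : Exp := ifEq c P.preferred (countExp x) (.num 0)

/-- See `ScoreData.rank`; the voter is variable `1`. -/
def rankExp : Exp :=
  .sum (.ite (.var 1) nExp (ifEq (topExp (.var 1)) (topExp (.var 3))
    (.ite (P.price (.var 3)) (P.price (.var 1)) (.num 1)
      (ifEq (P.price (.var 3)) (P.price (.var 1)) (ifLe (.var 3) (.var 1) (.num 1) (.num 0))
        (.num 0))) (.num 0)) (.num 0))

/-- See `ScoreData.cost`; the score is variable `1`, the party is variable `6`. -/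
def costExp : Exp :=
  .sum (.ite (.var 1) nExp (ifEq (topExp (.var 1)) (.var 8)
    (.ite (.var 3) P.rankExp (P.price (.var 1)) (.num 0)) (.num 0)) (.num 0))

/-- The value of a table cell, computed from the previous row; the variables are
`f`, `e`, `b`, `a`, `c`. -/
def entryExp : Exp :=
  .ite (.var 4) mExp (.max
    (ifLe (.var 1) (.var 5) (ifLe (countExp (.var 1)) (.var 4)
      (ifLe (countAExp (.var 6) (.var 1)) (.var 3) (ifLe (P.countPExp (.var 6) (.var 1)) (.var 2)
        (.sub (.ld (cellExp (.var 6) (.sub (.var 5) (.var 1)) (.sub (.var 4) (countExp (.var 1)))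
          (.sub (.var 3) (countAExp (.var 6) (.var 1)))
          (.sub (.var 2) (P.countPExp (.var 6) (.var 1))))) P.costExp)
        (.num 0)) (.num 0)) (.num 0)) (.num 0))) (.num 0)

/-- Filling the table. -/
def fill : Stmt :=
  .seq (.store .len (.add (.ld (.num 2)) (.num 1)))
    (.loop (.loop (.loop (.loop (.loop
      (.store (cellExp (.add (.var 4) (.num 1)) (.var 3) (.var 2) (.var 1) (.var 0))
        P.entryExp))))))

/-- Reading the answer from the table. -/
def answer : Exp :=
  .ite (.num 0) (.sum (.sum (.sum
    (.ite (.num 0) (.ld (cellExp mExp nExp (.var 5) (.var 3) (.var 1)))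
      (ifLe (.mul (.var 5) (.ld (.num 5))) (.mul (.var 3) (.ld (.num 6)))
        (ifLe (.mul (.var 3) P.ρnum) (.mul (.var 1) P.ρden) (.num 1) (.num 0))
        (.num 0)) (.num 0))))) (.num 1) (.num 0)

/-- The memory contains the data `D`. -/
structure Holds (D : ScoreData) (N : ℕ) (mem : ℕ → ℕ) : Prop where
  m_lt : D.m < N
  n_lt : D.n < N
  m_eq : mem 0 = D.m
  n_eq : mem 1 = D.n
  B_eq : mem 2 = D.B
  tnum_eq : mem 3 = D.tnum
  tden_eq : mem 4 = D.tden
  φnum_eq : mem 5 = D.φnum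
  φden_eq : mem 6 = D.φden
  inA_eq : ∀ c < D.m, mem (7 + c) = D.inA c
  top_eq : ∀ i < D.n, mem (7 + D.m + i * D.m) = D.top i
  ρnum_eq : ∀ env, P.ρnum.eval N mem env = D.ρnum
  ρden_eq : ∀ env, P.ρden.eval N mem env = D.ρden
  preferred_eq : ∀ env, P.preferred.eval N mem env = D.preferred
  price_eq : ∀ env i, i.eval N mem env < D.n →
    (P.price i).eval N mem env = D.price (i.eval N mem env)

/-- The address of a table cell. -/
def cell (N c a b e f : ℕ) : ℕ := N + (N * (N * (N * (N * c + a) + b) + e) + f)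

theorem horner_inj {N u v f g : ℕ} (hf : f < N) (hg : g < N) (h : N * u + f = N * v + g) :
    u = v ∧ f = g := by
  have hN : 0 < N := by omega
  have h₁ := congrArg (· / N) h
  have h₂ := congrArg (· % N) h
  simp only [Nat.mul_add_div hN, Nat.div_eq_of_lt hf, Nat.div_eq_of_lt hg, add_zero] at h₁
  simp only [Nat.mul_add_mod, Nat.mod_eq_of_lt hf, Nat.mod_eq_of_lt hg] at h₂
  exact ⟨h₁, h₂⟩

/-- Past the offset `N`, an address is a number in base `N` with digits `a`, `b`, `e`, `f` and
leading part `c`; being leading, `c` needs no bound. -/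
theorem cell_inj {N c a b e f c' a' b' e' f' : ℕ} (ha : a < N) (hb : b < N) (he : e < N)
    (hf : f < N) (ha' : a' < N) (hb' : b' < N) (he' : e' < N) (hf' : f' < N)
    (h : cell N c a b e f = cell N c' a' b' e' f') :
    c = c' ∧ a = a' ∧ b = b' ∧ e = e' ∧ f = f' := by
  obtain ⟨h, h₁⟩ := horner_inj hf hf' (Nat.add_left_cancel h)
  obtain ⟨h, h₂⟩ := horner_inj he he' h
  obtain ⟨h, h₃⟩ := horner_inj hb hb' h
  obtain ⟨h, h₄⟩ := horner_inj ha ha' h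
  exact ⟨h, h₄, h₃, h₂, h₁⟩

theorem eval_cellExp {N : ℕ} {mem : ℕ → ℕ} {env : List ℕ} (c a b e f : Exp) :
    (cellExp c a b e f).eval N mem env = cell N (c.eval N mem env) (a.eval N mem env)
      (b.eval N mem env) (e.eval N mem env) (f.eval N mem env) := by
  simp [cellExp, cell, eval]

theorem sum_range_guard {n N : ℕ} (h : n ≤ N) (F : ℕ → ℕ) :
    (∑ i ∈ Finset.range N, if i < n then F i else 0) = ∑ i ∈ Finset.range n, F i := by
  rw [← Finset.sum_filter]
  congr 1
  ext i; simp; omega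

/-! ### Values of the expressions on a memory that holds the data -/

section Values

variable {P} {D : ScoreData} {N : ℕ} {mem : ℕ → ℕ} {env : List ℕ} (H : P.Holds D N mem)
include H

theorem Holds.eval_mExp : mExp.eval N mem env = D.m := by simp [mExp, eval, H.m_eq]

theorem Holds.eval_nExp : nExp.eval N mem env = D.n := by simp [nExp, eval, H.n_eq]

theorem Holds.eval_topExp {i : Exp} (hi : i.eval N mem env < D.n) :
    (topExp i).eval N mem env = D.top (i.eval N mem env) := by
  have h : i.eval N mem env ≤ N := hi.le.trans H.n_lt.le
  rw [← H.top_eq _ hi, topExp, eval, eval, eval, eval_mul _ h, H.eval_mExp, eval]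

theorem Holds.eval_countExp {x : Exp} (hx : x.eval N mem env ≤ N) :
    (countExp x).eval N mem env = D.count (x.eval N mem env) := by
  have hn : nExp.eval N mem env ≤ N := by rw [H.eval_nExp]; exact H.n_lt.le
  rw [countExp, eval_ifLe, eval_mul _ hn, eval_mul _ hx, H.eval_nExp, ScoreData.count]
  simp only [eval, H.tnum_eq, H.tden_eq, mul_comm]

theorem Holds.eval_countAExp {c x : Exp} (hc : c.eval N mem env < D.m)
    (hx : x.eval N mem env ≤ N) :
    (countAExp c x).eval N mem env = D.countA (c.eval N mem env) (x.eval N mem env) := by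
  have h := H.eval_countExp hx
  rw [countAExp, eval_mul _ (by rw [h]; exact (D.count_le _).trans hx), h, ScoreData.countA,
    ← H.inA_eq _ hc]
  rfl

theorem Holds.eval_countPExp {c x : Exp} (hx : x.eval N mem env ≤ N) :
    (P.countPExp c x).eval N mem env = D.countP (c.eval N mem env) (x.eval N mem env) := by
  rw [countPExp, eval_ifEq, H.eval_countExp hx, H.preferred_eq, ScoreData.countP, eval]

theorem Holds.eval_rankExp {acc i : ℕ} (hi : i < D.n) :
    P.rankExp.eval N mem (acc :: i :: env) = D.rank i := by
  rw [ScoreData.rank, ← sum_range_guard H.n_lt.le, rankExp]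
  refine eval_sum fun j _ acc' => ?_
  rw [eval, H.eval_nExp]
  by_cases hj : j < D.n
  · have h₁ : (Exp.var 1).eval N mem (acc' :: j :: acc :: i :: env) = j := rfl
    -- The inner sum binds an accumulator and a counter, which shifts the voter `i` from variable
    -- `1` to variable `3`.
    have h₃ : (Exp.var 3).eval N mem (acc' :: j :: acc :: i :: env) = i := rfl
    rw [eval_ifEq, H.eval_topExp (by rwa [h₁]), H.eval_topExp (by rwa [h₃]), eval_ite, eval_ifEq,
      H.price_eq _ _ (by rwa [h₃]), H.price_eq _ _ (by rwa [h₁]), eval_ifLe, h₁, h₃]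
    simp only [eval, if_pos hj]
    split_ifs <;> first | rfl | omega
  · have h₁ : (Exp.var 1).eval N mem (acc' :: j :: acc :: i :: env) = j := rfl
    rw [h₁, if_neg hj, if_neg hj, eval]

theorem Holds.eval_costExp {acc x f e b a c : ℕ} :
    P.costExp.eval N mem (acc :: x :: f :: e :: b :: a :: c :: env) = D.cost c x := by
  rw [ScoreData.cost, ← sum_range_guard H.n_lt.le, costExp]
  refine eval_sum fun i _ acc' => ?_
  rw [eval, H.eval_nExp]
  have h₁ : (Exp.var 1).eval N mem (acc' :: i :: acc :: x :: f :: e :: b :: a :: c :: env) = i :=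
    rfl
  by_cases hi : i < D.n
  · rw [eval_ifEq, H.eval_topExp (by rwa [h₁]), eval_ite, H.eval_rankExp hi,
      H.price_eq _ _ (by rwa [h₁]), h₁]
    simp only [eval, if_pos hi, List.getD_cons_succ, List.getD_cons_zero]
    split_ifs <;> first | rfl | omega
  · rw [h₁, if_neg hi, if_neg hi, eval]

theorem Holds.eval_entryExp {f e b a c : ℕ} (ha : a < N) (hb : b < N) (he : e < N) (hf : f < N)
    (htab : ∀ a < N, ∀ b < N, ∀ e < N, ∀ f < N, mem (cell N c a b e f) = D.table N c a b e f) :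
    P.entryExp.eval N mem (f :: e :: b :: a :: c :: env) = D.table N (c + 1) a b e f := by
  rw [ScoreData.table, entryExp, eval, H.eval_mExp]
  change (if c < D.m then _ else _) = _
  -- The loop runs over all `c < N`, but coalition indicators are stored only for `c < D.m`; later
  -- rows are set to `0`.
  by_cases hc : c < D.m
  · rw [if_pos hc, if_pos hc]
    refine eval_max fun x hx acc => ?_
    have h₁ : (Exp.var 1).eval N mem (acc :: x :: f :: e :: b :: a :: c :: env) = x := rfl
    have h₆ : (Exp.var 6).eval N mem (acc :: x :: f :: e :: b :: a :: c :: env) = c := rfl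
    simp only [eval_ifLe, eval, eval_cellExp, H.eval_countExp (h₁.trans_le hx.le),
      H.eval_countAExp (h₆.trans_lt hc) (h₁.trans_le hx.le),
      H.eval_countPExp (h₁.trans_le hx.le), H.eval_costExp, List.getD_cons_succ,
      List.getD_cons_zero]
    rw [htab (a - x) (by omega) (b - D.count x) (by omega) (e - D.countA c x) (by omega)
      (f - D.countP c x) (by omega)]
    split_ifs <;> first | rfl | omega
  · rw [if_neg hc, if_neg hc, eval]

theorem Holds.eval_answer
    (htab : ∀ b < N, ∀ e < N, ∀ f < N, mem (cell N D.m D.n b e f) = D.table N D.m D.n b e f) :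
    (D.Feasible → P.answer.eval N mem env = 1) ∧ (¬ D.Feasible → P.answer.eval N mem env = 0) := by
  classical
  have hsum : P.answer.eval N mem env = if 0 < ∑ b ∈ Finset.range N, ∑ e ∈ Finset.range N,
      ∑ f ∈ Finset.range N, (if 0 < D.table N D.m D.n b e f ∧
      D.φnum * b ≤ D.φden * e ∧ D.ρnum * e ≤ D.ρden * f then 1 else 0) then 1 else 0 := by
    rw [answer, eval]
    refine if_congr (Iff.of_eq (congrArg (_ < ·) ?_)) rfl rfl
    refine eval_sum fun b hb acc => eval_sum fun e he acc' => eval_sum fun f hf acc'' => ?_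
    have h₅ : (Exp.var 5).eval N mem (acc'' :: f :: acc' :: e :: acc :: b :: env) ≤ N := hb.le
    have h₃ : (Exp.var 3).eval N mem (acc'' :: f :: acc' :: e :: acc :: b :: env) ≤ N := he.le
    have h₁ : (Exp.var 1).eval N mem (acc'' :: f :: acc' :: e :: acc :: b :: env) ≤ N := hf.le
    rw [eval_ite, eval_ld, eval_cellExp, H.eval_mExp, H.eval_nExp, eval_ifLe, eval_ifLe,
      eval_mul _ h₅, eval_mul _ h₃, eval_mul _ h₃, eval_mul _ h₁, H.ρnum_eq, H.ρden_eq]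
    simp only [eval, List.getD_cons_succ, List.getD_cons_zero, H.φnum_eq, H.φden_eq]
    rw [htab b hb e he f hf]
    -- The machine multiplies with the small index first, as the guard of `mul` demands; the
    -- inequalities have the rational's part first.
    simp only [mul_comm b, mul_comm e, mul_comm f]
    split_ifs <;> first | rfl | omega
  rw [hsum, D.feasible_iff_table H.n_lt]
  simp only [Finset.sum_pos_iff, Finset.mem_range]
  refine ⟨?_, fun h => if_neg fun ⟨b, hb, e, he, f, hf, hpos⟩ => ?_⟩
  · rintro ⟨b, hb, e, he, f, hf, h⟩
    exact if_pos ⟨b, hb, e, he, f, hf, by rw [if_pos h]; exact one_pos⟩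
  · refine h ⟨b, hb, e, he, f, hf, ?_⟩
    by_contra hn
    rw [if_neg hn] at hpos
    exact hpos.false

end Values

/-! ### Correctness of filling the table -/

/-- The input `input` is intact and the table cells in `A` are correct. -/
structure Correct (D : ScoreData) (N : ℕ) (input : ℕ → ℕ) (A : Set (ℕ × ℕ × ℕ × ℕ × ℕ))
    (mem : ℕ → ℕ) : Prop where
  input_eq : ∀ a < N, mem a = input a
  valid : ∀ c a b e f, (c, a, b, e, f) ∈ A → a < N ∧ b < N ∧ e < N ∧ f < N
  cell_eq : ∀ c a b e f, (c, a, b, e, f) ∈ A → mem (cell N c a b e f) = D.table N c a b e f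

/-- Table addresses start at `N`, so the input survives. Valid indices have distinct addresses, so a
write can hit an earlier correct cell only if it is the same cell and receives the same value. -/
theorem Correct.store {D : ScoreData} {N : ℕ} {input mem : ℕ → ℕ}
    {A : Set (ℕ × ℕ × ℕ × ℕ × ℕ)} (h : Correct D N input A mem) {c a b e f : ℕ} (ha : a < N)
    (hb : b < N) (he : e < N) (hf : f < N) :
    Correct D N input (A ∪ {(c, a, b, e, f)})
      (Function.update mem (cell N c a b e f) (D.table N c a b e f)) := by
  refine ⟨fun i hi => ?_, fun c' a' b' e' f' hq => ?_, fun c' a' b' e' f' hq => ?_⟩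
  · rw [Function.update_of_ne (by unfold cell; omega)]
    exact h.input_eq i hi
  · rcases hq with hq | hq
    · exact h.valid _ _ _ _ _ hq
    · simp only [Set.mem_singleton_iff, Prod.mk.injEq] at hq
      obtain ⟨rfl, rfl, rfl, rfl, rfl⟩ := hq
      exact ⟨ha, hb, he, hf⟩
  · by_cases hq' : cell N c' a' b' e' f' = cell N c a b e f
    · obtain ⟨ha', hb', he', hf'⟩ : a' < N ∧ b' < N ∧ e' < N ∧ f' < N := by
        rcases hq with hq | hq
        · exact h.valid _ _ _ _ _ hq
        · simp only [Set.mem_singleton_iff, Prod.mk.injEq] at hq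
          obtain ⟨rfl, rfl, rfl, rfl, rfl⟩ := hq
          exact ⟨ha, hb, he, hf⟩
      obtain ⟨rfl, rfl, rfl, rfl, rfl⟩ := cell_inj ha' hb' he' hf' ha hb he hf hq'
      rw [Function.update_self]
    · rw [Function.update_of_ne hq']
      rcases hq with hq | hq
      · exact h.cell_eq _ _ _ _ _ hq
      · simp only [Set.mem_singleton_iff, Prod.mk.injEq] at hq
        obtain ⟨rfl, rfl, rfl, rfl, rfl⟩ := hq
        exact absurd rfl hq'

/-- Row `c + 1` is computed from row `c`, which is complete by then. Row `0` needs one write only: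
its other entries are `0`, and so is the memory behind the input. -/
theorem run_fill {D : ScoreData} {N : ℕ} {input : ℕ → ℕ} (hzero : ∀ a, N ≤ a → input a = 0)
    (H : ∀ mem, (∀ a < N, mem a = input a) → P.Holds D N mem) :
    (∀ a < N, (P.fill.run N [] input) a = input a) ∧
      ∀ c ≤ D.m, ∀ a < N, ∀ b < N, ∀ e < N, ∀ f < N,
        (P.fill.run N [] input) (cell N c a b e f) = D.table N c a b e f := by
  have H₀ := H input fun _ _ => rfl
  have hN : 0 < N := (Nat.zero_le _).trans_lt H₀.n_lt
  let A₀ : Set (ℕ × ℕ × ℕ × ℕ × ℕ) :=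
    {q | q.1 = 0 ∧ q.2.1 < N ∧ q.2.2.1 < N ∧ q.2.2.2.1 < N ∧ q.2.2.2.2 < N}
  have hstart : Correct D N input A₀ (Function.update input N (D.B + 1)) := by
    refine ⟨fun a ha => Function.update_of_ne ha.ne _ _, fun c a b e f hq => hq.2,
      fun c a b e f hq => ?_⟩
    obtain ⟨hc, ha, hb, he, hf⟩ := hq
    simp only at hc ha hb he hf
    subst hc
    rw [ScoreData.table]
    -- The single initial write, to address `N`, is exactly the cell of the empty sum.
    have hcell : cell N 0 0 0 0 0 = N := by simp [cell]
    split_ifs with h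
    · obtain ⟨rfl, rfl, rfl, rfl⟩ := h
      rw [hcell, Function.update_self]
    · rw [Function.update_of_ne, hzero]
      · unfold cell; omega
      · intro h'
        rw [← hcell] at h'
        exact h (cell_inj ha hb he hf hN hN hN hN h').2
  let Q : ℕ → Set (ℕ × ℕ × ℕ × ℕ × ℕ) := fun c => ⋃ a ∈ Set.Iio N, ⋃ b ∈ Set.Iio N,
    ⋃ e ∈ Set.Iio N, ⋃ f ∈ Set.Iio N, {(c + 1, a, b, e, f)}
  have hQ : ∀ c a b e f, a < N → b < N → e < N → f < N → (c + 1, a, b, e, f) ∈ Q c := by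
    intro c a b e f ha hb he hf
    simp [Q, ha, hb, he, hf]
  have hrun : Correct D N input (A₀ ∪ ⋃ c ∈ Set.Iio N, Q c) (P.fill.run N [] input) := by
    rw [fill, Stmt.run, Stmt.run]
    have hB : (Exp.add (.ld (.num 2)) (.num 1)).eval N input [] = D.B + 1 := by
      simp [eval, H₀.B_eq]
    rw [hB]
    refine Stmt.run_loop_of_step (Correct D N input) A₀ Q (fun c hc mem A' hA hrows h => ?_) hstart
    have hrow : ∀ a < N, ∀ b < N, ∀ e < N, ∀ f < N, (c, a, b, e, f) ∈ A' := by
      intro a ha b hb e he f hf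
      rcases c with _ | c
      · exact hA ⟨rfl, ha, hb, he, hf⟩
      · exact hrows c (Nat.lt_succ_self c) (hQ c a b e f ha hb he hf)
    refine Stmt.run_loop_of_step _ A' _ (fun a ha mem A₁ hA₁ _ h => ?_) h
    refine Stmt.run_loop_of_step _ A₁ _ (fun b hb mem A₂ hA₂ _ h => ?_) h
    refine Stmt.run_loop_of_step _ A₂ _ (fun e he mem A₃ hA₃ _ h => ?_) h
    refine Stmt.run_loop_of_step _ A₃ _ (fun f hf mem A₄ hA₄ _ h => ?_) h
    rw [Stmt.run, eval_cellExp, (H mem h.input_eq).eval_entryExp ha hb he hf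
      fun a ha b hb e he f hf => h.cell_eq _ _ _ _ _
        (hA₄ (hA₃ (hA₂ (hA₁ (hrow a ha b hb e he f hf)))))]
    exact h.store ha hb he hf
  refine ⟨hrun.input_eq, fun c hc a ha b hb e he f hf => hrun.cell_eq _ _ _ _ _ ?_⟩
  rcases c with _ | c
  · exact Or.inl ⟨rfl, ha, hb, he, hf⟩
  · exact Or.inr (Set.mem_biUnion (Set.mem_Iio.2 (hc.trans H₀.m_lt.le))
      (hQ c a b e f ha hb he hf))

/-- A problem whose instances contain the data of a dynamic program is decided in polynomial
time. -/
theorem polyTimeDecidable {α : Type} {encode : α → List ℕ} {L : α → Prop} (data : α → ScoreData)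
    (hL : ∀ I, L I ↔ (data I).Feasible)
    (H : ∀ I mem, (∀ a < (encode I).length, mem a = (encode I).getD a 0) →
      P.Holds (data I) (encode I).length mem) : PolyTimeDecidable encode L := by
  refine polyTimeDecidable_of_run P.fill P.answer fun I => ?_
  obtain ⟨h₁, h₂⟩ := run_fill (P := P) (D := data I) (N := (encode I).length)
    (input := (init (encode I)).mem) (fun a ha => List.getD_eq_default _ _ ha) (H I)
  have h := (H I _ h₁).eval_answer (env := []) (h₂ _ le_rfl _ (H I _ h₁).n_lt)
  rw [hL]
  exact h

end InputForm

end CoalitionBribery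

/-! ## The four problems -/

namespace CoalitionBribery

open RAM RAM.Exp

/-- The data of the dynamic program for an instance; the preferred party and the target ratio are
given separately. -/
def CB.scoreData (I : CB) (ρnum ρden preferred : ℕ) (p : Fin I.E.n → ℕ) : ScoreData where
  m := I.E.m
  n := I.E.n
  B := I.B
  tnum := I.threshold.num
  tden := I.threshold.den
  φnum := I.φ.num
  φden := I.φ.den
  ρnum := ρnum
  ρden := ρden
  preferred := preferred
  inA c := if h : c < I.E.m then if ⟨c, h⟩ ∈ I.A then 1 else 0 else 0
  top i := if h : i < I.E.n then (favourite I.E.m_pos (I.E.order ⟨i, h⟩) : ℕ) else 0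
  price i := if h : i < I.E.n then p ⟨i, h⟩ else 0
  inA_le_one c := by split_ifs <;> omega

section

variable (I : CB) (ρnum ρden preferred : ℕ) (p : Fin I.E.n → ℕ)

theorem CB.scoreData_rank (i : Fin I.E.n) : (I.scoreData ρnum ρden preferred p).rank i =
    dearRank (Finset.univ.filter fun j =>
      favourite I.E.m_pos (I.E.order j) = favourite I.E.m_pos (I.E.order i)) p i := by
  rw [ScoreData.rank]
  change ∑ j ∈ Finset.range I.E.n, _ = _
  rw [Finset.sum_range, dearRank, Finset.filter_filter, Finset.card_filter]
  refine Finset.sum_congr rfl fun j _ => ?_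
  simp [CB.scoreData, Fin.ext_iff]

theorem CB.scoreData_cost (c : Fin I.E.m) (x : ℕ) :
    (I.scoreData ρnum ρden preferred p).cost c x =
      reductionCost I.E.m_pos I.E.order p c x := by
  rw [ScoreData.cost]
  change ∑ i ∈ Finset.range I.E.n, _ = _
  rw [Finset.sum_range, reductionCost, Finset.filter_filter, Finset.sum_filter]
  refine Finset.sum_congr rfl fun i _ => ?_
  have htop : (I.scoreData ρnum ρden preferred p).top i = c ↔
      favourite I.E.m_pos (I.E.order i) = c := by simp [CB.scoreData, Fin.ext_iff]
  have hprice : (I.scoreData ρnum ρden preferred p).price i = p i := by simp [CB.scoreData]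
  rw [I.scoreData_rank, hprice]
  refine if_congr ?_ rfl rfl
  rw [htop]
  refine and_congr_right fun h => ?_
  rw [h]

theorem CB.scoreData_count (x : ℕ) : (I.scoreData ρnum ρden preferred p).count x =
    countedScore I.E.n I.threshold x := rfl

theorem CB.scoreData_sum_countA (x : Fin I.E.m → ℕ) :
    ∑ c : Fin I.E.m, (I.scoreData ρnum ρden preferred p).countA c (x c) =
      ∑ c ∈ I.A, countedScore I.E.n I.threshold (x c) := by
  rw [← Finset.univ_inter I.A, ← Finset.filter_mem_eq_inter, Finset.sum_filter]
  refine Finset.sum_congr rfl fun c _ => ?_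
  rw [ScoreData.countA, CB.scoreData_count]
  simp [CB.scoreData]

theorem CB.scoreData_feasible_iff :
    (I.scoreData ρnum ρden preferred p).Feasible ↔ ∃ x : Fin I.E.m → ℕ, ∑ c, x c = I.E.n ∧
      ∑ c, reductionCost I.E.m_pos I.E.order p c (x c) ≤ I.B ∧
      I.φ.num * ∑ c, countedScore I.E.n I.threshold (x c) ≤
        I.φ.den * ∑ c ∈ I.A, countedScore I.E.n I.threshold (x c) ∧
      ρnum * ∑ c ∈ I.A, countedScore I.E.n I.threshold (x c) ≤
        ρden * ∑ c : Fin I.E.m, if (c : ℕ) = preferred then countedScore I.E.n I.threshold (x c) else 0 := by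
  have key : ∀ x : ℕ → ℕ, (∑ c ∈ Finset.range I.E.m, x c = I.E.n ∧
      ∑ c ∈ Finset.range I.E.m, (I.scoreData ρnum ρden preferred p).cost c (x c) ≤ I.B ∧
      I.φ.num * ∑ c ∈ Finset.range I.E.m, (I.scoreData ρnum ρden preferred p).count (x c) ≤
        I.φ.den * ∑ c ∈ Finset.range I.E.m, (I.scoreData ρnum ρden preferred p).countA c (x c) ∧
      ρnum * ∑ c ∈ Finset.range I.E.m, (I.scoreData ρnum ρden preferred p).countA c (x c) ≤
        ρden * ∑ c ∈ Finset.range I.E.m,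
          (I.scoreData ρnum ρden preferred p).countP c (x c)) ↔ _ := fun x => by
    simp only [Finset.sum_range, I.scoreData_cost,
      I.scoreData_sum_countA ρnum ρden preferred p fun c => x c, ScoreData.countP,
      CB.scoreData_count]
    exact Iff.rfl
  constructor
  · rintro ⟨x, hx⟩
    exact ⟨fun c => x c, (key x).1 hx⟩
  · rintro ⟨x, hx⟩
    -- Values beyond the last party are irrelevant, as all sums stop at `I.E.m`.
    refine ⟨fun c => if h : c < I.E.m then x ⟨c, h⟩ else 0, (key _).2 ?_⟩
    simp only [Fin.is_lt, dite_true, Fin.eta]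
    exact hx

end

/-- With target ratio `0 / 1` the condition on the preferred party is void, so its dummy value `0`
has no influence. -/
theorem CB.solvable_iff_feasible (I : CB) (p : Fin I.E.n → ℕ) :
    I.Solvable plurality (dollarPrice I.E.m p) ↔ (I.scoreData 0 1 0 p).Feasible := by
  rw [cb_solvable_iff, I.scoreData_feasible_iff]
  simp

theorem CBP.solvable_iff_feasible (I : CBP) (p : Fin I.E.n → ℕ) :
    I.Solvable plurality (dollarPrice I.E.m p) ↔
      (I.toCB.scoreData I.ρ.num I.ρ.den I.preferred p).Feasible := by
  rw [cbp_solvable_iff, I.toCB.scoreData_feasible_iff]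
  simp only [← Fin.ext_iff, Finset.sum_ite_eq', Finset.mem_univ, if_true]

/-- Blocks of equal length `m` start at the multiples of `m`; this locates the first place in each
voter's order. -/
theorem getD_flatten_mul {m : ℕ} (hm : 0 < m) {l : List (List ℕ)} (hl : ∀ w ∈ l, w.length = m)
    {i : ℕ} (hi : i < l.length) : l.flatten.getD (i * m) 0 = (l.getD i []).getD 0 0 := by
  induction l generalizing i with
  | nil => simp at hi
  | cons w l ih =>
    have hw : w.length = m := hl w (by simp)
    rw [List.flatten_cons]
    rcases i with _ | i
    · rw [List.getD_append _ _ _ _ (by omega), zero_mul, List.getD_cons_zero]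
    · rw [List.getD_append_right _ _ _ _ (by rw [hw, add_mul]; omega), hw, List.getD_cons_succ,
        ← ih (fun v hv => hl v (by simp [hv])) (by simpa using hi)]
      congr 1
      rw [add_mul, one_mul, Nat.add_sub_cancel]

theorem getD_ofFn {k : ℕ} {β : Type} (g : Fin k → β) {i : ℕ} (hi : i < k) (b : β) :
    (List.ofFn g).getD i b = g ⟨i, hi⟩ := by
  simp [List.getD_eq_getElem?_getD, hi]

theorem CB.length_encode (I : CB) : I.encode.length = 7 + I.E.m + I.E.n * I.E.m := by
  simp [CB.encode, List.length_flatten, List.map_ofFn, Function.comp_def]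
  omega

/-- The number at place `k` behind the part of the input that all four problems share. -/
def tailExp (k : Exp) : Exp := .ld (.add (.add (.add (.num 7) mExp) (.mul nExp mExp)) k)

/-! ### Reading an instance from its encoding -/

section Encoding

variable {I : CB} {tail : List ℕ} {mem : ℕ → ℕ}
  (hmem : ∀ a < (I.encode ++ tail).length, mem a = (I.encode ++ tail).getD a 0)
include hmem

theorem mem_of_lt {a : ℕ} (ha : a < 7 + I.E.m + I.E.n * I.E.m) : mem a = I.encode.getD a 0 := by
  have hlen := I.length_encode
  rw [hmem a (by rw [List.length_append]; omega), List.getD_append _ _ _ _ (by omega)]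

theorem mem_header {a : ℕ} (ha : a < 7) : mem a =
    [I.E.m, I.E.n, I.B, I.threshold.num, I.threshold.den, I.φ.num, I.φ.den].getD a 0 := by
  rw [mem_of_lt hmem (by omega), CB.encode, List.append_assoc,
    List.getD_append _ _ _ _ (by simpa using ha)]

theorem mem_coalition {c : ℕ} (hc : c < I.E.m) : mem (7 + c) = if ⟨c, hc⟩ ∈ I.A then 1 else 0 := by
  rw [mem_of_lt hmem (by omega), CB.encode, List.append_assoc,
    List.getD_append_right _ _ _ _ (by simp), List.getD_append _ _ _ _ (by simpa using hc),
    show 7 + c - List.length _ = c by simp, getD_ofFn _ hc]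

theorem mem_top {i : ℕ} (hi : i < I.E.n) :
    mem (7 + I.E.m + i * I.E.m) = (favourite I.E.m_pos (I.E.order ⟨i, hi⟩) : ℕ) := by
  have hlt : i * I.E.m < I.E.n * I.E.m := Nat.mul_lt_mul_of_pos_right hi I.E.m_pos
  rw [mem_of_lt hmem (by omega), CB.encode, List.getD_append_right _ _ _ _ (by simp; omega)]
  have h : 7 + I.E.m + i * I.E.m - ([I.E.m, I.E.n, I.B, I.threshold.num, I.threshold.den, I.φ.num,
      I.φ.den] ++ List.ofFn fun c : Fin I.E.m => if c ∈ I.A then 1 else 0).length = i * I.E.m := by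
    simp; omega
  rw [h, getD_flatten_mul I.E.m_pos (by simp [List.mem_ofFn]) (by simpa using hi),
    getD_ofFn _ hi, getD_ofFn _ I.E.m_pos]
  rfl

theorem eval_tailExp {k : Exp} {env : List ℕ}
    (hk : k.eval (I.encode ++ tail).length mem env < tail.length) :
    (tailExp k).eval (I.encode ++ tail).length mem env =
      tail.getD (k.eval (I.encode ++ tail).length mem env) 0 := by
  have hlen := I.length_encode
  have hlen' : (I.encode ++ tail).length = 7 + I.E.m + I.E.n * I.E.m + tail.length := by
    rw [List.length_append, hlen]
  have hm : mExp.eval (I.encode ++ tail).length mem env = I.E.m :=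
    mem_header hmem (a := 0) (by omega)
  have hn : nExp.eval (I.encode ++ tail).length mem env = I.E.n :=
    mem_header hmem (a := 1) (by omega)
  -- Listing all orders makes the input at least `n` entries long, so the product `n * m` passes the
  -- guard of `mul`.
  have hle : I.E.n ≤ I.E.n * I.E.m := Nat.le_mul_of_pos_right _ I.E.m_pos
  rw [tailExp, eval_ld, eval, eval, eval, eval_mul _ (by omega), hm, hn, eval_num,
    hmem _ (by omega), List.getD_append_right _ _ _ _ (by omega)]
  congr 1
  omega

theorem InputForm.holds_scoreData {P : InputForm} {ρnum ρden preferred : ℕ} {p : Fin I.E.n → ℕ}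
    (hρnum : ∀ env, P.ρnum.eval (I.encode ++ tail).length mem env = ρnum)
    (hρden : ∀ env, P.ρden.eval (I.encode ++ tail).length mem env = ρden)
    (hpref : ∀ env, P.preferred.eval (I.encode ++ tail).length mem env = preferred)
    (hprice : ∀ env i (hi : i.eval (I.encode ++ tail).length mem env < I.E.n),
      (P.price i).eval (I.encode ++ tail).length mem env = p ⟨_, hi⟩) :
    P.Holds (I.scoreData ρnum ρden preferred p) (I.encode ++ tail).length mem where
  m_lt := by
    rw [List.length_append, I.length_encode]
    simp only [CB.scoreData]
    omega
  n_lt := by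
    have hle : I.E.n ≤ I.E.n * I.E.m := Nat.le_mul_of_pos_right _ I.E.m_pos
    rw [List.length_append, I.length_encode]
    simp only [CB.scoreData]
    omega
  m_eq := mem_header hmem (by omega)
  n_eq := mem_header hmem (by omega)
  B_eq := mem_header hmem (by omega)
  tnum_eq := mem_header hmem (by omega)
  tden_eq := mem_header hmem (by omega)
  φnum_eq := mem_header hmem (by omega)
  φden_eq := mem_header hmem (by omega)
  inA_eq c hc := (mem_coalition hmem hc).trans
    (dif_pos (c := _ < I.E.m) (t := fun h => if ⟨c, h⟩ ∈ I.A then 1 else 0) hc).symm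
  top_eq i hi := (mem_top hmem hi).trans
    (dif_pos (c := _ < I.E.n) (t := fun h => (favourite I.E.m_pos (I.E.order ⟨i, h⟩) : ℕ)) hi).symm
  ρnum_eq := hρnum
  ρden_eq := hρden
  preferred_eq := hpref
  price_eq env i hi := (hprice env i hi).trans
    (dif_pos (c := _ < I.E.n) (t := fun h => p ⟨_, h⟩) hi).symm

end Encoding

/-! ### The four variants -/

theorem cb_polyTimeDecidable : PolyTimeDecidable CB.encode
    (fun I => I.Solvable plurality (unitPrice I.E.m I.E.n)) := by
  let P : InputForm := ⟨.num 0, .num 1, .num 0, fun _ => .num 1⟩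
  -- Unit prices are, by definitional unfolding, individual prices that all equal `1`.
  refine P.polyTimeDecidable (fun I => I.scoreData 0 1 0 fun _ => 1)
    (fun I => I.solvable_iff_feasible _) fun I mem hmem => ?_
  rw [← List.append_nil I.encode] at hmem ⊢
  exact InputForm.holds_scoreData hmem (fun _ => rfl) (fun _ => rfl) (fun _ => rfl)
    fun _ _ _ => rfl

theorem dollarCB_polyTimeDecidable : PolyTimeDecidable DollarCB.encode
    (fun I => I.toCB.Solvable plurality (dollarPrice I.E.m I.price)) := by
  let P : InputForm := ⟨.num 0, .num 1, .num 0, tailExp⟩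
  refine P.polyTimeDecidable (fun I => I.toCB.scoreData 0 1 0 I.price)
    (fun I => I.toCB.solvable_iff_feasible _) fun I mem hmem => ?_
  rw [DollarCB.encode] at hmem ⊢
  refine InputForm.holds_scoreData hmem (fun _ => rfl) (fun _ => rfl) (fun _ => rfl)
    fun env i hi => ?_
  exact (eval_tailExp hmem (by simpa using hi)).trans (getD_ofFn _ hi 0)

theorem cbp_polyTimeDecidable : PolyTimeDecidable CBP.encode
    (fun I => I.Solvable plurality (unitPrice I.E.m I.E.n)) := by
  let P : InputForm := ⟨tailExp (.num 1), tailExp (.num 2), tailExp (.num 0), fun _ => .num 1⟩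
  refine P.polyTimeDecidable (fun I => I.toCB.scoreData I.ρ.num I.ρ.den I.preferred fun _ => 1)
    (fun I => I.solvable_iff_feasible _) fun I mem hmem => ?_
  rw [CBP.encode] at hmem ⊢
  exact InputForm.holds_scoreData hmem
    (fun _ => eval_tailExp hmem (k := .num 1) (by simp [eval]))
    (fun _ => eval_tailExp hmem (k := .num 2) (by simp [eval]))
    (fun _ => eval_tailExp hmem (k := .num 0) (by simp [eval])) fun _ _ _ => rfl

theorem dollarCBP_polyTimeDecidable : PolyTimeDecidable DollarCBP.encode
    (fun I => I.toCBP.Solvable plurality (dollarPrice I.E.m I.price)) := by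
  -- The tail lists the preferred party, then numerator and denominator of `ρ`, then the prices,
  -- which therefore start at offset `3`.
  let P : InputForm := ⟨tailExp (.num 1), tailExp (.num 2), tailExp (.num 0),
    fun i => tailExp (.add (.num 3) i)⟩
  refine P.polyTimeDecidable
    (fun I => I.toCB.scoreData I.ρ.num I.ρ.den I.preferred I.price)
    (fun I => I.toCBP.solvable_iff_feasible _) fun I mem hmem => ?_
  rw [DollarCBP.encode, CBP.encode, List.append_assoc] at hmem ⊢
  refine InputForm.holds_scoreData hmem
    (fun _ => eval_tailExp hmem (k := .num 1) (by simp [eval]))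
    (fun _ => eval_tailExp hmem (k := .num 2) (by simp [eval]))
    (fun _ => eval_tailExp hmem (k := .num 0) (by simp [eval])) fun env i hi => ?_
  refine (eval_tailExp hmem (k := .add (.num 3) i) ?_).trans ?_
  · simp only [eval, List.length_append, List.length_cons, List.length_nil, List.length_ofFn] at hi ⊢
    omega
  · rw [eval, eval_num, List.getD_append_right _ _ _ _ (by simp)]
    simp only [List.length_cons, List.length_nil, Nat.add_sub_cancel_left]
    exact getD_ofFn _ hi 0

end CoalitionBribery

open CoalitionBribery RAM in
theorem mainTheorem11 :
    PolyTimeDecidable CB.encode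
      (fun I => I.Solvable plurality (unitPrice I.E.m I.E.n)) ∧
    PolyTimeDecidable DollarCB.encode
      (fun I => I.toCB.Solvable plurality (dollarPrice I.E.m I.price)) ∧
    PolyTimeDecidable CBP.encode
      (fun I => I.Solvable plurality (unitPrice I.E.m I.E.n)) ∧
    PolyTimeDecidable DollarCBP.encode
      (fun I => I.toCBP.Solvable plurality (dollarPrice I.E.m I.price)) := by
  exact ⟨cb_polyTimeDecidable, dollarCB_polyTimeDecidable, cbp_polyTimeDecidable,
    dollarCBP_polyTimeDecidable⟩
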